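/- Let $k\ge 1$ be an integer, $R>0$, $T>0$, $b\in\mathbb R$, $I=(0,R)$, $Q_T=(0,T)\times I$. Consider the problem $$u_t+bu_x+u_{xxx}+(g(u))_x=f(t,x)\ \text{ in } Q_T,\qquad u|_{t=0}=u_0,\quad u|_{x=0}=\mu_0,\quad u|_{x=R}=\nu_0,\quad u_x|_{x=R}=\nu_1. \tag{P}$$ Notation. $H^s(0,T)$ is the space of restrictions to $(0,T)$ of functions from $H^s(\mathbb R)=\{\mu:(1+\xi^2)^{s/2}\widehat\mu\in L_2(\mathbb R)\}$. $X^k(Q_T)$ is the space of functions $u(t,x)$ such that $\partial_t^m u\in C([0,T];L_2(I))\cap L_2(0,T;H^1(I))$ for $0\le m\le k$ and $\partial_t^m u|_{t=0}\in H^{3(k-m)}(I)$ for $0\le m\le k-1$. $M^k(Q_T)$ is the space of functions $f(t,x)$ such that $\partial_t^m f\in L_2(Q_T)$ for $0\le m\le k$ and $\partial_t^m f|_{t=0}\in H^{3(k-m-1)}(I)$ for $0\le m\le k-1$ (where $f$ is modified on a null set so that $\partial_t^m f\in C([0,T];L_2(I))$, $0\le m\le k-1$). The functions $\Phi_m=\Phi_m(\cdot\,;u_0,f)$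 on $I$ are defined by $\Phi_0=u_0$ and, for $m\ge1$, $$\Phi_m=\partial_t^{m-1}f|_{t=0}-(b\Phi_{m-1}'+\Phi_{m-1}''')-\Bigl(\sum_{l=0}^{m-1}g^{(l)}(u_0)\sum_{\substack{n_1+\dots+n_l=m-1\\ n_i\ge1}}\frac{(m-1)!}{l!\,n_1!\cdots n_l!}\,\Phi_{n_1}\cdots\Phi_{n_l}\Bigr)'$$ (for $m=1$ the sum is $g(u_0)$). A function $u\in X^k(Q_T)$ is a solution of (P) if $$\iint_{Q_T}\bigl[u(\phi_t+b\phi_x+\phi_{xxx})+f\phi+g(u)\phi_x\bigr]dx\,dt+\int_I u_0\,\phi|_{t=0}\,dx+\int_0^T\bigl(\mu_0\phi_{xx}|_{x=0}-\nu_0\phi_{xx}|_{x=R}+\nu_1\phi_x|_{x=R}\bigr)dt=0$$ for all smooth $\phi(t,x)$ with $\phi|_{t=T}=0$ and $\phi|_{x=0}=\phi_x|_{x=0}=\phi|_{x=R}=0$. Corollary 1.1. Let $g\in C^{3k-1}(\mathbb R)$, $g(0)=g'(0)=0$, $u_0\in H^{3k}(I)$, $\mu_0,\nu_0\in H^{k+1/3}(0,T)$,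 $\nu_1\in H^k(0,T)$, $f\in M^k(Q_T)$, and let the compatibility conditions $$\mu_0^{(m)}(0)=\Phi_m(0),\qquad \nu_0^{(m)}(0)=\Phi_m(R),\qquad \nu_1^{(m)}(0)=\Phi_m'(R),\qquad 0\le m\le k-1,$$ hold. Assume in addition that $$\partial_t^m f\in C([0,T];H^{3(k-m-1)}(I))\cap L_2(0,T;H^{3(k-m)-2}(I)),\qquad 0\le m\le k-1.$$ Let $u\in X^k(Q_T)$ be a solution of (P). Then $$\partial_t^m u\in C([0,T];H^{3(k-m)}(I))\cap L_2(0,T;H^{3(k-m)+1}(I)),\qquad 0\le m\le k-1.$$ -/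

import Mathlib

open Set MeasureTheory Filter
open scoped ContDiff ENNReal

noncomputable section

namespace GKdV

/-- `v` is the `m`-th weak (Sobolev) derivative on the interval `(a, b)` of the function `u` with
values in a Banach space `E`: both are locally integrable and
`∫ φ⁽ᵐ⁾ u = (-1)ᵐ ∫ φ v` for all smooth `φ` with compact support in `(a, b)`.
It is used with `E = ℝ` (functions of `x` on `(0, R)`, functions of `t` on `(0, T)`) and with
`E = L₂(0, R)` (the derivative `∂ₜᵐ` of a function of `(t, x)`). -/
def IsWeakDeriv {E : Type*} [NormedAddCommGroup E] [NormedSpace ℝ E]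
    (a b : ℝ) (m : ℕ) (u v : ℝ → E) : Prop :=
  LocallyIntegrableOn u (Ioo a b) ∧ LocallyIntegrableOn v (Ioo a b) ∧
  ∀ φ : ℝ → ℝ, ContDiff ℝ ∞ φ → HasCompactSupport φ → tsupport φ ⊆ Ioo a b →
    ∫ y in Ioo a b, iteratedDeriv m φ y • u y = (-1 : ℝ) ^ m • ∫ y in Ioo a b, φ y • v y

open Classical in
/-- The `m`-th weak derivative of `u` on `(a, b)` (determined up to a null set; `0` if there is
none). -/
def weakDeriv {E : Type*} [NormedAddCommGroup E] [NormedSpace ℝ E]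
    (a b : ℝ) (m : ℕ) (u : ℝ → E) : ℝ → E :=
  if h : ∃ v, IsWeakDeriv a b m u v then h.choose else 0

open Classical in
/-- The value at the point `y ∈ [a, b]` of the continuous representative on `[a, b]` of the `m`-th
weak derivative of `u` (`0` if there is no such representative). -/
def traceDeriv {E : Type*} [NormedAddCommGroup E] [NormedSpace ℝ E]
    (a b : ℝ) (m : ℕ) (u : ℝ → E) (y : ℝ) : E :=
  if h : ∃ v, IsWeakDeriv a b m u v ∧ ContinuousOn v (Icc a b) then h.choose y else 0

/-- The space `L₂(I)`, `I = (0, R)`. A function of `(t, x)` is treated as a function of `t` with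
values in this space; thus `L₂(Q_T) = L₂(0, T; L₂(I))`. -/
abbrev L2 (R : ℝ) : Type := Lp ℝ 2 (volume.restrict (Ioo (0 : ℝ) R))

/-- An element of `L₂(I)` multiplied by a test function is integrable. -/
theorem integrable_test (R : ℝ) (v : L2 R) (φ : ℝ → ℝ) (hφ : Continuous φ)
    (hc : HasCompactSupport φ) :
    Integrable (fun y => φ y • v y) (volume.restrict (Ioo (0 : ℝ) R)) :=
  ((Lp.memLp v).locallyIntegrable (by norm_num)).integrable_smul_left_of_hasCompactSupport hφ hc

/-- The Sobolev space `Hⁿ(I)`, `I = (0, R)`: a function `v ∈ L₂(I)` with weak derivatives up to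
order `n` in `L₂(I)` is given by the tuple `(v, v', …, v⁽ⁿ⁾)`; the norm is
`(∑ⱼ ‖v⁽ʲ⁾‖²)^{1/2}`. -/
def H (R : ℝ) (n : ℕ) : Submodule ℝ (PiLp 2 (fun _ : Fin (n + 1) => L2 R)) where
  carrier := {V | ∀ j : Fin (n + 1), IsWeakDeriv 0 R j (V 0) (V j)}
  zero_mem' := by
    have h0 : ∀ φ : ℝ → ℝ,
        ∫ y in Ioo (0 : ℝ) R, φ y • ((0 : L2 R) : ℝ → ℝ) y = 0 := by
      intro φ
      refine integral_eq_zero_of_ae ?_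
      filter_upwards [Lp.coeFn_zero ℝ 2 (volume.restrict (Ioo (0 : ℝ) R))] with y hy
      rw [hy]
      simp
    have hl : LocallyIntegrableOn ((0 : L2 R) : ℝ → ℝ) (Ioo 0 R) :=
      IntegrableOn.locallyIntegrableOn ((Lp.memLp (0 : L2 R)).integrable (by norm_num))
    intro j
    refine ⟨hl, hl, fun φ _ _ _ => ?_⟩
    simp only [PiLp.zero_apply]
    rw [h0, h0, smul_zero]
  add_mem' := by
    intro V W hV hW j
    refine ⟨IntegrableOn.locallyIntegrableOn ((Lp.memLp ((V + W) 0)).integrable (by norm_num)),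
      IntegrableOn.locallyIntegrableOn ((Lp.memLp ((V + W) j)).integrable (by norm_num)),
      fun φ h1 h2 h3 => ?_⟩
    have key : ∀ (i : Fin (n + 1)) (ψ : ℝ → ℝ), Continuous ψ → HasCompactSupport ψ →
        ∫ y in Ioo (0 : ℝ) R, ψ y • (V + W) i y =
          (∫ y in Ioo (0 : ℝ) R, ψ y • V i y) + ∫ y in Ioo (0 : ℝ) R, ψ y • W i y := by
      intro i ψ hψ hc
      rw [← integral_add (integrable_test R _ ψ hψ hc) (integrable_test R _ ψ hψ hc)]
      refine integral_congr_ae ?_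
      filter_upwards [Lp.coeFn_add (V i) (W i)] with y hy
      simp only [PiLp.add_apply, hy, Pi.add_apply, smul_add]
    have hd : ContDiff ℝ ∞ (iteratedDeriv (j : ℕ) φ) := by
      rw [iteratedDeriv_eq_iterate]
      exact h1.iterate_deriv _
    have hcs : HasCompactSupport (iteratedDeriv (j : ℕ) φ) := by
      rw [iteratedDeriv_eq_iterate]
      clear hd
      induction (j : ℕ) with
      | zero => simpa using h2
      | succ i ih => rw [Function.iterate_succ_apply']; exact ih.deriv
    rw [key 0 _ hd.continuous hcs, key j _ h1.continuous h2, (hV j).2.2 φ h1 h2 h3,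
      (hW j).2.2 φ h1 h2 h3, smul_add]
  smul_mem' := by
    intro c V hV j
    refine ⟨IntegrableOn.locallyIntegrableOn ((Lp.memLp ((c • V) 0)).integrable (by norm_num)),
      IntegrableOn.locallyIntegrableOn ((Lp.memLp ((c • V) j)).integrable (by norm_num)),
      fun φ h1 h2 h3 => ?_⟩
    have key : ∀ (i : Fin (n + 1)) (ψ : ℝ → ℝ),
        ∫ y in Ioo (0 : ℝ) R, ψ y • (c • V) i y = c • ∫ y in Ioo (0 : ℝ) R, ψ y • V i y := by
      intro i ψ
      rw [← integral_smul]
      refine integral_congr_ae ?_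
      filter_upwards [Lp.coeFn_smul c (V i)] with y hy
      simp only [PiLp.smul_apply, hy, Pi.smul_apply, smul_comm (ψ y) c]
    rw [key, key, (hV j).2.2 φ h1 h2 h3, smul_comm]

/-- `v ∈ Hⁿ(I)`. -/
def MemH (R : ℝ) (n : ℕ) (v : ℝ → ℝ) : Prop :=
  ∃ V : H R n, v =ᵐ[volume.restrict (Ioo 0 R)] V.1 0

/-- `u ∈ C([0,T]; Hⁿ(I))`. -/
def MemCH (R T : ℝ) (n : ℕ) (u : ℝ → L2 R) : Prop :=
  ∃ U : ℝ → H R n, ContinuousOn U (Icc 0 T) ∧ ∀ t ∈ Icc 0 T, u t = (U t).1 0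

/-- `u ∈ L₂(0,T; Hⁿ(I))`. -/
def MemL2H (R T : ℝ) (n : ℕ) (u : ℝ → L2 R) : Prop :=
  ∃ U : ℝ → H R n, MemLp U 2 (volume.restrict (Ioo 0 T)) ∧
    ∀ᵐ t ∂(volume.restrict (Ioo 0 T)), u t = (U t).1 0

/-- `μ ∈ Hˢ(0,T)`, `s ≥ 0`: `μ` is the restriction to `(0,T)` of a function from `Hˢ(ℝ)`, the
latter space being defined through the Fourier transform. -/
def MemFracH (T s : ℝ) (μ : ℝ → ℝ) : Prop :=
  ∃ F : Lp ℂ 2 (volume : Measure ℝ),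
    TemperedDistribution.MemSobolev s 2 (F : TemperedDistribution ℝ ℂ) ∧
    ∀ᵐ t ∂(volume.restrict (Ioo 0 T)), F t = (μ t : ℂ)

/-- The space `X^k(Q_T)`: `∂ₜᵐ u ∈ C([0,T]; L₂(I)) ∩ L₂(0,T; H¹(I))` for `0 ≤ m ≤ k` and
`∂ₜᵐ u|_{t=0} ∈ H^{3(k-m)}(I)` for `0 ≤ m ≤ k-1`. -/
def MemX (k : ℕ) (R T : ℝ) (u : ℝ → L2 R) : Prop :=
  ∀ m ≤ k, ∃ v : ℝ → L2 R, IsWeakDeriv 0 T m u v ∧ ContinuousOn v (Icc 0 T) ∧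
    MemL2H R T 1 v ∧ (m < k → MemH R (3 * (k - m)) (v 0))

/-- The space `M^k(Q_T)`: `∂ₜᵐ f ∈ L₂(Q_T)` for `0 ≤ m ≤ k` and, for `0 ≤ m ≤ k-1`, the continuous
representative of `∂ₜᵐ f` satisfies `∂ₜᵐ f|_{t=0} ∈ H^{3(k-m-1)}(I)`. -/
def MemM (k : ℕ) (R T : ℝ) (f : ℝ → L2 R) : Prop :=
  (∀ m ≤ k, ∃ v : ℝ → L2 R, IsWeakDeriv 0 T m f v ∧ MemLp v 2 (volume.restrict (Ioo 0 T))) ∧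
  (∀ m < k, ∃ v : ℝ → L2 R, IsWeakDeriv 0 T m f v ∧ ContinuousOn v (Icc 0 T) ∧
    MemH R (3 * (k - m - 1)) (v 0))

/-- The functions `Φ_m(·; u₀, f)`: `Φ₀ = u₀` and
`Φ_{m+1} = ∂ₜᵐ f|_{t=0} - (b Φ_m' + Φ_m''') - (∂ₜᵐ g(u)|_{t=0})'`, where `∂ₜᵐ g(u)` is expanded by
Faà di Bruno's formula
`∂ₜᵐ g(u) = ∑ₗ g⁽ˡ⁾(u) ∑_{n₁+⋯+nₗ=m, nᵢ≥1} m!/(l! n₁!⋯nₗ!) ∂ₜ^{n₁}u ⋯ ∂ₜ^{nₗ}u`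
and `∂ₜⁿ u` is replaced by `Φ_n`. The double sum runs over the compositions `(n₁, …, nₗ)` of `m`. -/
def Phi (R T b : ℝ) (g u₀ : ℝ → ℝ) (f : ℝ → L2 R) : ℕ → ℝ → ℝ
  | 0 => u₀
  | m + 1 => fun x =>
      traceDeriv 0 T m f 0 x
        - (b * weakDeriv 0 R 1 (Phi R T b g u₀ f m) x + weakDeriv 0 R 3 (Phi R T b g u₀ f m) x)
        - weakDeriv 0 R 1 (fun y => ∑ c : Composition m,
            ((m.factorial : ℝ) / ((c.length.factorial : ℝ) * ∏ i, ((c.blocksFun i).factorial : ℝ))) *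
              iteratedDeriv c.length g (u₀ y) *
              ∏ i : Fin c.length, Phi R T b g u₀ f (c.blocksFun i) y) x
  decreasing_by
  all_goals first
    | exact Nat.lt_succ_self _
    | exact Nat.lt_succ_of_le (c.blocksFun_le i)

/-- `φ` is a test function: smooth on `[0,T] × [0,R]`, with `φ|_{t=T} = 0` and
`φ|_{x=0} = φ_x|_{x=0} = φ|_{x=R} = 0`. -/
structure IsTestFunction (R T : ℝ) (φ : ℝ → ℝ → ℝ) : Prop where
  smooth : ContDiff ℝ ∞ (Function.uncurry φ)
  final : ∀ x ∈ Icc 0 R, φ T x = 0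
  left : ∀ t ∈ Icc 0 T, φ t 0 = 0
  left_deriv : ∀ t ∈ Icc 0 T, deriv (φ t) 0 = 0
  right : ∀ t ∈ Icc 0 T, φ t R = 0

/-- `u` is a (weak) solution in `Q_T = (0,T) × (0,R)` of
`u_t + b u_x + u_xxx + (g(u))_x = f`, `u|_{t=0} = u₀`, `u|_{x=0} = μ₀`, `u|_{x=R} = ν₀`,
`u_x|_{x=R} = ν₁`, in the sense of the integral identity. (The smooth test functions are dense in
the test functions `φ ∈ L₂(0,T; H³(I))`, `φ_t ∈ L₂(Q_T)` with the same boundary conditions, so for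
`u` in the class `X^k(Q_T)`, `k ≥ 1`, both choices give the same notion.) -/
def IsSolution (R T b : ℝ) (g u₀ μ₀ ν₀ ν₁ : ℝ → ℝ) (f u : ℝ → L2 R) : Prop :=
  ∀ φ : ℝ → ℝ → ℝ, IsTestFunction R T φ →
    (∫ t in Ioo 0 T, ∫ x in Ioo 0 R,
        (u t x * (deriv (fun s => φ s x) t + b * deriv (φ t) x + iteratedDeriv 3 (φ t) x)
          + f t x * φ t x + g (u t x) * deriv (φ t) x))
      + (∫ x in Ioo 0 R, u₀ x * φ 0 x)
      + (∫ t in Ioo 0 T, (μ₀ t * iteratedDeriv 2 (φ t) 0 - ν₀ t * iteratedDeriv 2 (φ t) R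
          + ν₁ t * deriv (φ t) R)) = 0

end GKdV

end

/-! The equation expresses `u_xxx` as `f - u_t - b u_x - (g(u))_x`, so one time derivative can be
traded for three space derivatives. Put `N = k - 1`. By induction on `j`, `∂ₜᵐ u` lies in `C(H^{3j})
∩ L₂(H^{3j+1})` for all `m ≤ N + 1 - j`; the case `j = 0` is part of `u ∈ X^k`, and `j = k - m` is
the claim (`regularity_induction`).

In the step, `∂ₜᵐ u` and `∂ₜᵐ⁺¹ u` both lie in `L₂(H^{3j+1})`, hence `∂ₜᵐ u ∈ C(H^{3j+1})`
(`MemL2H.memCH`). The lower order terms then have time derivatives in `C(H^{3j})`, the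
differentiated equation (`IsSolution.isWeakDeriv_three`) puts `∂ₓ³∂ₜᵐ u` in `C(H^{3j})`, and
integrating three times gives `C(H^{3j+3})` (`exists_lift`). This gain makes the lower order terms
one degree better, so a second pass through the equation gives `L₂(H^{3j+4})`.

The nonlinearity is handled without Faà di Bruno's formula: an element of `Hⁿ⁺¹(I)` is written `c +
∫₀ˣ v` with `v ∈ Hⁿ(I)`, and `g(c + ∫₀ˣ v) = g(c) + ∫₀ˣ g'(·) v`. Iterating this and the product
rule shows that `g ∈ C^{M+n+1}` maps `C^M([0,T]; Hⁿ⁺¹)` to itself (`SmoothC.nemytskii`). -/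

noncomputable section

namespace GKdV

open scoped Topology BoundedContinuousFunction

/-! ### Calculus in the algebra of continuous functions -/

section Nemytskii

variable {K : Type*} [TopologicalSpace K] [CompactSpace K]

/-- The superposition operator `w ↦ g ∘ w` on continuous functions. -/
def nemytskii (g : C(ℝ, ℝ)) : C(K, ℝ) → C(K, ℝ) := fun w => g.comp w

/-- The mean value inequality is applied at each `x` to `y ↦ g y - g' (w x) * y`. The bound is
uniform in `x` because `w ↦ g' ∘ w` is continuous for the uniform norm. -/
theorem hasFDerivAt_nemytskii (g g' : C(ℝ, ℝ)) (h : ∀ x, HasDerivAt g (g' x) x) (w : C(K, ℝ)) :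
    HasFDerivAt (nemytskii g) (ContinuousLinearMap.mul ℝ C(K, ℝ) (nemytskii g' w)) w := by
  rw [hasFDerivAt_iff_isLittleO_nhds_zero, Asymptotics.isLittleO_iff]
  intro ε hε
  have hc : Continuous (nemytskii (K := K) g') := ContinuousMap.continuous_postcomp g'
  obtain ⟨δ, hδ, H⟩ := Metric.continuousAt_iff.1 (hc.continuousAt (x := w)) ε hε
  filter_upwards [Metric.ball_mem_nhds (0 : C(K, ℝ)) hδ] with v hv
  rw [mem_ball_zero_iff] at hv
  rw [ContinuousMap.norm_le _ (by positivity)]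
  intro x
  have hb : ∀ y ∈ segment ℝ (w x) (w x + v x), |g' y - g' (w x)| ≤ ε := by
    rintro y hy
    rw [segment_eq_image'] at hy
    obtain ⟨θ, hθ, rfl⟩ := hy
    have h1 : dist (w + θ • v) w < δ := by
      rw [dist_eq_norm, add_sub_cancel_left, norm_smul, Real.norm_of_nonneg hθ.1]
      exact (mul_le_of_le_one_left (norm_nonneg _) hθ.2).trans_lt hv
    have h2 := (ContinuousMap.dist_lt_iff hε).1 (H h1) x
    rw [Real.dist_eq] at h2
    have h3 : w x + θ • (w x + v x - w x) = (w + θ • v) x := by simp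
    change |g' (w x + θ • (w x + v x - w x)) - g' (w x)| ≤ ε
    rw [h3]
    exact h2.le
  have key := (convex_segment (w x) (w x + v x)).norm_image_sub_le_of_norm_hasDerivWithin_le
    (f := fun y => g y - g' (w x) * y) (f' := fun y => g' y - g' (w x) * 1) (C := ε)
    (fun y _ => ((h y).sub ((hasDerivAt_id y).const_mul _)).hasDerivWithinAt)
    (fun y hy => by simpa using hb y hy) (left_mem_segment ℝ _ _) (right_mem_segment ℝ _ _)
  have h4 : (nemytskii g (w + v) - nemytskii g w -
      (ContinuousLinearMap.mul ℝ C(K, ℝ) (nemytskii g' w)) v) x =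
      g (w x + v x) - g' (w x) * (w x + v x) - (g (w x) - g' (w x) * w x) := by
    simp [nemytskii]
    ring
  rw [h4]
  refine key.trans ?_
  rw [add_sub_cancel_left]
  exact mul_le_mul_of_nonneg_left (v.norm_coe_le_norm x) hε.le

theorem contDiff_nemytskii (n : ℕ) (g : C(ℝ, ℝ)) (hg : ContDiff ℝ n g) :
    ContDiff ℝ n (nemytskii (K := K) g) := by
  induction n generalizing g with
  | zero => exact contDiff_zero.2 (ContinuousMap.continuous_postcomp g)
  | succ n ih =>
    have hg' : ContDiff ℝ n (deriv g) := (contDiff_succ_iff_deriv.1 hg).2.2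
    have hd : Differentiable ℝ g := hg.differentiable (by simp)
    rw [Nat.cast_succ, contDiff_succ_iff_hasFDerivAt]
    refine ⟨fun w => ContinuousLinearMap.mul ℝ C(K, ℝ) (nemytskii ⟨deriv g, hg'.continuous⟩ w),
      ?_, hasFDerivAt_nemytskii g _ fun x => (hd x).hasDerivAt⟩
    exact (ContinuousLinearMap.contDiff (E := C(K, ℝ)) (F := C(K, ℝ) →L[ℝ] C(K, ℝ))
      (ContinuousLinearMap.mul ℝ C(K, ℝ))).comp (ih ⟨deriv g, hg'.continuous⟩ hg')

end Nemytskii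

/-! ### Continuous functions, integration and multiplication on `L₂(I)` -/

section Spatial

variable {R : ℝ}

/-- The space `C[0, R]`. -/
abbrev CI (R : ℝ) : Type := C(Icc (0 : ℝ) R, ℝ)

theorem integrable_coe (v : L2 R) : Integrable v (volume.restrict (Ioo (0 : ℝ) R)) :=
  (Lp.memLp v).integrable (by norm_num)

/-- The constant functions in `C[0, R]`. -/
def constL : ℝ →L[ℝ] CI R := (ContinuousLinearMap.id ℝ ℝ).smulRight (1 : CI R)

theorem constL_apply (c : ℝ) (x : Icc (0 : ℝ) R) : constL c x = c := by
  simp [constL]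

variable [hR : Fact (0 < R)]

/-- Extension of a function in `C[0, R]` to a bounded continuous function on the line. -/
def extendL : CI R →L[ℝ] (ℝ →ᵇ ℝ) :=
  LinearMap.mkContinuous
    { toFun := fun w => (BoundedContinuousFunction.mkOfCompact w).compContinuous
        ⟨projIcc 0 R hR.out.le, continuous_projIcc⟩
      map_add' := fun _ _ => rfl
      map_smul' := fun _ _ => rfl } 1 (fun w => by
        rw [BoundedContinuousFunction.norm_le (by positivity), one_mul]
        exact fun x => w.norm_coe_le_norm _)

theorem extendL_apply (w : CI R) {x : ℝ} (hx : x ∈ Icc 0 R) : extendL w x = w ⟨x, hx⟩ := by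
  change w (projIcc 0 R hR.out.le x) = _
  rw [projIcc_of_mem _ hx]

/-- The embedding of `C[0, R]` into `L₂(I)`. -/
def embL : CI R →L[ℝ] L2 R :=
  (BoundedContinuousFunction.toLp 2 (volume.restrict (Ioo (0 : ℝ) R)) ℝ).comp extendL

theorem embL_ae (w : CI R) : embL w =ᵐ[volume.restrict (Ioo (0 : ℝ) R)] extendL w :=
  BoundedContinuousFunction.coeFn_toLp 2 _ ℝ (extendL w)

theorem denseRange_embL : DenseRange (embL (R := R)) := by
  refine (BoundedContinuousFunction.toLp_denseRange ℝ (volume.restrict (Ioo (0 : ℝ) R)) ℝ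
    (p := 2) (by norm_num)).mono ?_
  rintro _ ⟨f, rfl⟩
  refine ⟨f.toContinuousMap.restrict (Icc 0 R), ?_⟩
  refine Lp.ext ((embL_ae _).trans ?_)
  refine EventuallyEq.trans ?_ (BoundedContinuousFunction.coeFn_toLp 2 _ ℝ f).symm
  filter_upwards [ae_restrict_mem measurableSet_Ioo] with x hx
  rw [extendL_apply _ (Ioo_subset_Icc_self hx)]
  rfl

/-- Multiplication of an element of `L₂(I)` by a continuous function. -/
def mulL : CI R →L[ℝ] L2 R →L[ℝ] L2 R :=
  ((ContinuousLinearMap.mul ℝ ℝ).holderL (volume.restrict (Ioo (0 : ℝ) R)) ∞ 2 2).comp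
    ((BoundedContinuousFunction.toLp ∞ (volume.restrict (Ioo (0 : ℝ) R)) ℝ).comp extendL)

theorem mulL_ae (w : CI R) (v : L2 R) :
    mulL w v =ᵐ[volume.restrict (Ioo (0 : ℝ) R)] fun x => extendL w x * v x := by
  have h1 := (ContinuousLinearMap.mul ℝ ℝ).coeFn_holder (r := 2)
    (BoundedContinuousFunction.toLp ∞ (volume.restrict (Ioo (0 : ℝ) R)) ℝ (extendL w)) v
  have h2 := BoundedContinuousFunction.coeFn_toLp ∞ (volume.restrict (Ioo (0 : ℝ) R)) ℝ (extendL w)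
  filter_upwards [h1, h2] with x hx1 hx2
  rw [← hx2]
  exact hx1

theorem mulL_embL (w z : CI R) : mulL w (embL z) = embL (w * z) := by
  refine Lp.ext ((mulL_ae w _).trans ?_)
  filter_upwards [embL_ae z, embL_ae (w * z)] with x h1 h2
  rw [h1, h2]
  rfl

theorem intervalIntegrable_coe (v : L2 R) {x y : ℝ} (hx : x ∈ Icc 0 R) (hy : y ∈ Icc 0 R) :
    IntervalIntegrable v volume x y := by
  have h : IntervalIntegrable v volume 0 R := by
    rw [intervalIntegrable_iff_integrableOn_Ioo_of_le hR.out.le]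
    exact integrable_coe v
  refine h.mono_set ?_
  rw [uIcc_of_le hR.out.le]
  exact uIcc_subset_Icc hx hy

theorem continuousOn_primitive_coe (v : L2 R) :
    ContinuousOn (fun x => ∫ y in (0 : ℝ)..x, v y) (Icc 0 R) := by
  have h := intervalIntegral.continuousOn_primitive_interval' (a := 0)
    (intervalIntegrable_coe v (left_mem_Icc.2 hR.out.le) (right_mem_Icc.2 hR.out.le))
    left_mem_uIcc
  rwa [uIcc_of_le hR.out.le] at h

/-- The primitive `x ↦ ∫₀ˣ v` of an element of `L₂(I)`, as a continuous function. -/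
def primFun (v : L2 R) : CI R where
  toFun x := ∫ y in (0 : ℝ)..x, v y
  continuous_toFun := (continuousOn_primitive_coe v).domRestrict

theorem primFun_apply (v : L2 R) (x : Icc (0 : ℝ) R) : primFun v x = ∫ y in (0 : ℝ)..x, v y := rfl

/-- Written as an inner product, the primitive is visibly linear in `v`, and Cauchy–Schwarz gives
the bound `√R` used in `primL`. -/
theorem primFun_eq_inner (v : L2 R) (x : Icc (0 : ℝ) R) :
    primFun v x = inner ℝ (indicatorConstLp 2 (μ := volume.restrict (Ioo (0 : ℝ) R))
      (measurableSet_Ioo (a := 0) (b := (x : ℝ))) (measure_ne_top _ _) (1 : ℝ)) v := by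
  rw [L2.inner_indicatorConstLp_one, Measure.restrict_restrict measurableSet_Ioo,
    inter_eq_left.2 (Ioo_subset_Ioo_right x.2.2), primFun_apply,
    intervalIntegral.integral_of_le x.2.1, integral_Ioc_eq_integral_Ioo]

/-- The operator `v ↦ ∫₀ˣ v` from `L₂(I)` to `C[0, R]`. -/
def primL : L2 R →L[ℝ] CI R :=
  LinearMap.mkContinuous
    { toFun := primFun
      map_add' := fun v w => by
        ext x
        rw [ContinuousMap.add_apply, primFun_eq_inner, primFun_eq_inner, primFun_eq_inner,
          inner_add_right]
      map_smul' := fun c v => by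
        ext x
        rw [ContinuousMap.smul_apply, primFun_eq_inner, primFun_eq_inner, inner_smul_right]
        rfl } (√ R) (fun v => by
        refine (ContinuousMap.norm_le _ (by positivity)).2 fun x => ?_
        change ‖primFun v x‖ ≤ _
        rw [primFun_eq_inner]
        refine (norm_inner_le_norm _ _).trans (mul_le_mul_of_nonneg_right ?_ (norm_nonneg _))
        rw [norm_indicatorConstLp (by norm_num) (by norm_num), norm_one, one_mul,
          measureReal_restrict_apply measurableSet_Ioo, inter_eq_left.2 (Ioo_subset_Ioo_right x.2.2),
          Real.volume_real_Ioo_of_le x.2.1, sub_zero, Real.sqrt_eq_rpow]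
        simpa using Real.rpow_le_rpow x.2.1 x.2.2 (by norm_num : (0 : ℝ) ≤ 1 / 2))

theorem primL_apply (v : L2 R) (x : Icc (0 : ℝ) R) : primL v x = ∫ y in (0 : ℝ)..x, v y := rfl

/-- The value at the left end of the interval. -/
def evalZero : CI R →L[ℝ] ℝ := ContinuousMap.evalCLM ℝ ⟨0, left_mem_Icc.2 hR.out.le⟩

theorem evalZero_const_add_prim (c : ℝ) (v : L2 R) : evalZero (constL c + primL v) = c := by
  change constL c _ + primL v _ = c
  rw [constL_apply, primL_apply]
  simp

theorem hasDerivAt_primL_embL (h : CI R) {x : ℝ} (hx : x ∈ Ioo 0 R) :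
    HasDerivAt (extendL (primL (embL h))) (extendL h x) x := by
  have h1 : HasDerivAt (fun y => ∫ z in (0 : ℝ)..y, extendL h z) (extendL h x) x :=
    intervalIntegral.integral_hasDerivAt_right ((extendL h).continuous.intervalIntegrable _ _)
      ((extendL h).continuous.stronglyMeasurableAtFilter _ _) (extendL h).continuous.continuousAt
  refine h1.congr_of_eventuallyEq ?_
  filter_upwards [Ioo_mem_nhds hx.1 hx.2] with y hy
  rw [extendL_apply _ (Ioo_subset_Icc_self hy), primL_apply]
  refine intervalIntegral.integral_congr_ae_restrict ?_
  rw [uIoc_of_le hy.1.le]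
  exact ae_restrict_of_ae_restrict_of_subset (Ioc_subset_Ioo_right hy.2) (embL_ae h)

/-- The chain rule for primitives of `L₂` functions. Both sides are continuous in `v ∈ L₂(I)`, so it
suffices to take `v` continuous, where it is the fundamental theorem of calculus. -/
theorem nemytskii_const_add_prim (g g' : C(ℝ, ℝ)) (hg : ∀ x, HasDerivAt g (g' x) x) (c : ℝ)
    (v : L2 R) : nemytskii g (constL c + primL v) =
      constL (g c) + primL (mulL (nemytskii g' (constL c + primL v)) v) := by
  refine denseRange_embL.induction_on (p := fun v => nemytskii g (constL c + primL v) =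
    constL (g c) + primL (mulL (nemytskii g' (constL c + primL v)) v)) v (isClosed_eq ?_ ?_) ?_
  · exact (ContinuousMap.continuous_postcomp g).comp (by fun_prop)
  · have h : Continuous fun v : L2 R => nemytskii g' (constL c + primL v) :=
      (ContinuousMap.continuous_postcomp g').comp (by fun_prop)
    exact continuous_const.add (primL.continuous.comp
      ((mulL.continuous.comp h).clm_apply continuous_id))
  · intro h
    rw [mulL_embL]
    ext x
    set w : CI R := constL c + primL (embL h) with hw
    have hd : ∀ y ∈ Ioo (0 : ℝ) x, HasDerivAt (fun y => g (extendL w y))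
        (extendL (nemytskii g' w * h) y) y := by
      intro y hy
      have hy' : y ∈ Ioo 0 R := ⟨hy.1, hy.2.trans_le x.2.2⟩
      have h1 : HasDerivAt (extendL w) (extendL h y) y :=
        ((hasDerivAt_primL_embL h hy').const_add c).congr_of_eventuallyEq
          (Eventually.of_forall fun z => by
            rw [hw, map_add]
            change constL c _ + _ = _
            rw [constL_apply])
      exact (hg _).comp y h1
    have key := intervalIntegral.integral_eq_sub_of_hasDerivAt_of_le x.2.1
      (f := fun y => g (extendL w y))
      ((g.continuous.comp (extendL w).continuous).continuousOn) hd
      ((extendL (nemytskii g' w * h)).continuous.intervalIntegrable _ _)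
    rw [extendL_apply w x.2, extendL_apply w (left_mem_Icc.2 hR.out.le)] at key
    have h0 : w ⟨0, left_mem_Icc.2 hR.out.le⟩ = c := evalZero_const_add_prim c _
    have h2 : primL (embL (nemytskii g' w * h)) x =
        ∫ y in (0 : ℝ)..x, extendL (nemytskii g' w * h) y := by
      rw [primL_apply]
      refine intervalIntegral.integral_congr_ae_restrict ?_
      rw [uIoc_of_le x.2.1]
      have := embL_ae (nemytskii g' w * h)
      rw [← restrict_Ioo_eq_restrict_Ioc]
      exact ae_restrict_of_ae_restrict_of_subset (Ioo_subset_Ioo_right x.2.2) this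
    rw [ContinuousMap.add_apply, h2, key, h0, constL_apply]
    change g (w x) = _
    ring

/-- The product rule, by polarization: the chain rule with `g(x) = x²` is applied to both factors
and to their sum. -/
theorem const_add_prim_mul (c d : ℝ) (v w : L2 R) :
    (constL c + primL v) * (constL d + primL w) =
      constL (c * d) +
        primL (mulL (constL c + primL v) w + mulL (constL d + primL w) v) := by
  have sq : ∀ (c : ℝ) (v : L2 R), (constL c + primL v) * (constL c + primL v) =
      constL (c * c) + primL (mulL (constL c + primL v) v + mulL (constL c + primL v) v) := by
    intro c v
    have h := nemytskii_const_add_prim ⟨fun x => x * x, by fun_prop⟩ ⟨fun x => 2 * x, by fun_prop⟩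
      (fun x => by
        change HasDerivAt (fun x => x * x) (2 * x) x
        simpa [two_mul] using (hasDerivAt_id' x).fun_mul (hasDerivAt_id' x)) c v
    have h1 : nemytskii ⟨fun x => 2 * x, by fun_prop⟩ (constL c + primL v) =
        (constL c + primL v) + (constL c + primL v) := by
      ext x
      exact two_mul _
    rw [h1, map_add mulL, add_apply] at h
    exact h
  have h1 := sq (c + d) (v + w)
  have h2 := sq c v
  have h3 := sq d w
  have e : constL (c + d) + primL (v + w) = (constL c + primL v) + (constL d + primL w) := by
    rw [map_add, map_add]; abel
  have e2 : constL (R := R) ((c + d) * (c + d)) =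
      constL (c * c) + constL (d * d) + constL (c * d) + constL (c * d) := by
    ext x
    simp only [ContinuousMap.add_apply, constL_apply]
    ring
  rw [e, e2] at h1
  set a : CI R := constL c + primL v
  set b : CI R := constL d + primL w
  simp only [map_add, add_apply] at h1 h2 h3 ⊢
  have h4 : (2 : ℝ) • (a * b) = (2 : ℝ) • (constL (c * d) + (primL (mulL a w) + primL (mulL b v))) := by
    rw [two_smul, two_smul]
    linear_combination h1 - h2 - h3
  exact smul_right_injective _ (two_ne_zero) h4

end Spatial

/-! ### Test functions on an interval -/

/-- Smooth functions with compact support in `(a, b)`. -/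
structure IsTest (a b : ℝ) (φ : ℝ → ℝ) : Prop where
  smooth : ContDiff ℝ ∞ φ
  compact : HasCompactSupport φ
  subset : tsupport φ ⊆ Ioo a b

namespace IsTest

variable {a b : ℝ} {φ ψ : ℝ → ℝ}

theorem deriv (h : IsTest a b φ) : IsTest a b (deriv φ) where
  smooth := (contDiff_infty_iff_deriv.1 h.smooth).2
  compact := h.compact.deriv
  subset := (tsupport_deriv_subset (f := φ)).trans h.subset

theorem iteratedDeriv (h : IsTest a b φ) (m : ℕ) : IsTest a b (iteratedDeriv m φ) := by
  induction m with
  | zero => simpa using h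
  | succ m ih => rw [iteratedDeriv_succ]; exact ih.deriv

theorem eq_zero (h : IsTest a b φ) {x : ℝ} (hx : x ∉ Ioo a b) : φ x = 0 :=
  image_eq_zero_of_notMem_tsupport fun h' => hx (h.subset h')

theorem const_mul (h : IsTest a b φ) (c : ℝ) : IsTest a b (fun x => c * φ x) where
  smooth := contDiff_const.mul h.smooth
  compact := h.compact.mul_left
  subset := (tsupport_mul_subset_right (f := fun _ => c) (g := φ)).trans h.subset

theorem sub (h : IsTest a b φ) (h' : IsTest a b ψ) : IsTest a b (fun x => φ x - ψ x) where
  smooth := h.smooth.sub h'.smooth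
  compact := h.compact.sub h'.compact
  subset := (tsupport_sub φ ψ).trans (union_subset h.subset h'.subset)

/-- The primitive starting at `a` vanishes to the left of the support of `φ` trivially, and to its
right because the total integral is zero. -/
theorem exists_primitive (h : IsTest a b φ) (h0 : ∫ x in Ioo a b, φ x = 0) :
    ∃ ψ, IsTest a b ψ ∧ _root_.deriv ψ = φ := by
  have hd : ∀ x, HasDerivAt (fun x => ∫ y in a..x, φ y) (φ x) x := fun x =>
    intervalIntegral.integral_hasDerivAt_right (h.smooth.continuous.intervalIntegrable _ _)
      (h.smooth.continuous.stronglyMeasurableAtFilter _ _) h.smooth.continuous.continuousAt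
  have hde : _root_.deriv (fun x => ∫ y in a..x, φ y) = φ := funext fun x => (hd x).deriv
  rcases (tsupport φ).eq_empty_or_nonempty with he | hne
  · rw [tsupport_eq_empty_iff] at he
    subst he
    refine ⟨fun _ => 0, ⟨contDiff_const, HasCompactSupport.zero, ?_⟩, by ext; simp⟩
    have : tsupport (fun _ : ℝ => (0 : ℝ)) = ∅ := tsupport_eq_empty_iff.2 rfl
    simp [this]
  obtain ⟨p, hp, hpl⟩ := h.compact.isCompact.exists_isLeast hne
  obtain ⟨q, hq, hql⟩ := h.compact.isCompact.exists_isGreatest hne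
  have hz : ∀ x, x ∉ Icc p q → φ x = 0 := fun x hx =>
    image_eq_zero_of_notMem_tsupport fun h' => hx ⟨hpl h', hql h'⟩
  have hsupp : Function.support (fun x => ∫ y in a..x, φ y) ⊆ Icc p q := by
    intro x hx
    by_contra hxx
    refine hx ?_
    rw [mem_Icc, not_and_or, not_le, not_le] at hxx
    change ∫ y in a..x, φ y = 0
    have hap : a < p := (h.subset hp).1
    have hqb : q < b := (h.subset hq).2
    rcases hxx with hxp | hxq
    · refine intervalIntegral.integral_zero_ae (Eventually.of_forall fun y hy => hz y fun hy' => ?_)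
      rcases mem_uIoc.1 hy with h1 | h1
      · linarith [h1.2, hy'.1]
      · linarith [h1.2, hy'.1]
    · have h1 : ∫ y in b..x, φ y = 0 := by
        refine intervalIntegral.integral_zero_ae
          (Eventually.of_forall fun y hy => hz y fun hy' => ?_)
        rcases mem_uIoc.1 hy with h1 | h1
        · linarith [h1.1, hy'.2]
        · linarith [h1.1, hy'.2]
      have h2 : ∫ y in a..b, φ y = 0 := by
        rw [intervalIntegral.integral_of_le ((hap.le.trans (hpl hq)).trans hqb.le),
          integral_Ioc_eq_integral_Ioo, h0]
      rw [← intervalIntegral.integral_add_adjacent_intervals (b := b)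
        (h.smooth.continuous.intervalIntegrable _ _)
        (h.smooth.continuous.intervalIntegrable _ _), h1, h2, add_zero]
  have hts : tsupport (fun x => ∫ y in a..x, φ y) ⊆ Icc p q :=
    closure_minimal hsupp isClosed_Icc
  refine ⟨fun x => ∫ y in a..x, φ y, ⟨?_, ?_, ?_⟩, hde⟩
  · rw [contDiff_infty_iff_deriv, hde]
    exact ⟨fun x => (hd x).differentiableAt, h.smooth⟩
  · exact HasCompactSupport.of_support_subset_isCompact isCompact_Icc hsupp
  · exact hts.trans (Icc_subset_Ioo (h.subset hp).1 (h.subset hq).2)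

theorem integrableOn (h : IsTest a b φ) : IntegrableOn φ (Ioo a b) :=
  (h.smooth.continuous.integrable_of_hasCompactSupport h.compact).integrableOn

end IsTest

theorem exists_isTest_integral_eq_one {a b : ℝ} (hab : a < b) :
    ∃ θ, IsTest a b θ ∧ ∫ x in Ioo a b, θ x = 1 := by
  let B : ContDiffBump ((a + b) / 2) := ⟨(b - a) / 8, (b - a) / 4, by linarith, by linarith⟩
  have hs : tsupport (B.normed volume) ⊆ Ioo a b := by
    rw [B.tsupport_normed_eq, Real.closedBall_eq_Icc]
    refine Icc_subset_Ioo ?_ ?_ <;> simp only [B] <;> linarith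
  refine ⟨B.normed volume, ⟨B.contDiff_normed, B.hasCompactSupport_normed, hs⟩, ?_⟩
  rw [setIntegral_eq_integral_of_forall_compl_eq_zero, B.integral_normed]
  exact fun x hx => image_eq_zero_of_notMem_tsupport fun h' => hx (hs h')

/-! ### Weak derivatives of functions with values in a Banach space. -/

section BochnerValued

variable {E : Type*} [NormedAddCommGroup E] [NormedSpace ℝ E] {a b : ℝ}

theorem integrableOn_test_smul {φ : ℝ → ℝ} (hφ : IsTest a b φ) {u : ℝ → E}
    (hu : LocallyIntegrableOn u (Ioo a b)) : IntegrableOn (fun y => φ y • u y) (Ioo a b) := by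
  have h1 : IntegrableOn u (tsupport φ) :=
    hu.integrableOn_compact_subset hφ.subset hφ.compact.isCompact
  have h2 : IntegrableOn (fun y => φ y • u y) (tsupport φ) :=
    h1.continuousOn_smul hφ.smooth.continuous.continuousOn hφ.compact.isCompact
  refine ((integrableOn_iff_integrable_of_support_subset fun x hx => ?_).1 h2).integrableOn
  by_contra hx'
  exact hx (by simp [image_eq_zero_of_notMem_tsupport hx'])

/-- A function whose weak derivative vanishes is constant. -/
theorem exists_ae_eq_const [CompleteSpace E] (hab : a < b) {u : ℝ → E}
    (hu : LocallyIntegrableOn u (Ioo a b))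
    (h : ∀ φ, IsTest a b φ → ∫ y in Ioo a b, deriv φ y • u y = 0) :
    ∃ c, ∀ᵐ y ∂(volume.restrict (Ioo a b)), u y = c := by
  obtain ⟨θ, hθ, hθ1⟩ := exists_isTest_integral_eq_one hab
  refine ⟨∫ y in Ioo a b, θ y • u y, ?_⟩
  set c := ∫ y in Ioo a b, θ y • u y
  have := isOpen_Ioo.ae_eq_zero_of_integral_contDiff_smul_eq_zero (U := Ioo a b)
    (f := fun y => u y - c) (μ := volume)
    (hu.sub (continuous_const.locallyIntegrable.locallyIntegrableOn _)) ?_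
  · rw [ae_restrict_iff' measurableSet_Ioo]
    filter_upwards [this] with y hy hy' using sub_eq_zero.1 (hy hy')
  intro φ h1 h2 h3
  have hφ : IsTest a b φ := ⟨h1, h2, h3⟩
  set d := ∫ y in Ioo a b, φ y
  -- Du Bois-Reymond's argument: `φ - (∫ φ) θ` has mean zero, hence is the derivative of a test
  -- function. This forces the constant to be `∫ θ u`.
  obtain ⟨ψ, hψ, hψd⟩ := (hφ.sub (hθ.const_mul d)).exists_primitive (by
    rw [integral_sub hφ.integrableOn (hθ.const_mul d).integrableOn, integral_const_mul, hθ1]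
    ring)
  have h4 := h ψ hψ
  have i1 := integrableOn_test_smul hφ hu
  have i2 := integrableOn_test_smul hθ hu
  have h5 : (fun y => deriv ψ y • u y) = fun y => φ y • u y - d • (θ y • u y) := by
    rw [hψd]
    ext y
    rw [sub_smul, mul_smul]
  have i3 : IntegrableOn (fun y => d • (θ y • u y)) (Ioo a b) := i2.smul d
  rw [h5, integral_sub i1 i3, integral_smul] at h4
  rw [← setIntegral_eq_integral_of_forall_compl_eq_zero (s := Ioo a b)
    (fun x hx => by rw [hφ.eq_zero hx, zero_smul])]
  simp only [smul_sub]
  rw [integral_sub i1 (hφ.integrableOn.smul_const c), integral_smul_const]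
  exact h4

theorem IsWeakDeriv.ae_eq_of_zero [CompleteSpace E] {u v : ℝ → E} (h : IsWeakDeriv a b 0 u v) :
    ∀ᵐ y ∂(volume.restrict (Ioo a b)), u y = v y := by
  have := isOpen_Ioo.ae_eq_zero_of_integral_contDiff_smul_eq_zero (U := Ioo a b)
    (f := fun y => u y - v y) (μ := volume) (h.1.sub h.2.1) ?_
  · rw [ae_restrict_iff' measurableSet_Ioo]
    filter_upwards [this] with y hy hy' using sub_eq_zero.1 (hy hy')
  intro φ h1 h2 h3
  have hφ : IsTest a b φ := ⟨h1, h2, h3⟩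
  have h4 := h.2.2 φ h1 h2 h3
  simp only [iteratedDeriv_zero, pow_zero, one_smul] at h4
  rw [← setIntegral_eq_integral_of_forall_compl_eq_zero (s := Ioo a b)
    (fun x hx => by rw [hφ.eq_zero hx, zero_smul])]
  simp only [smul_sub]
  rw [integral_sub (integrableOn_test_smul hφ h.1) (integrableOn_test_smul hφ h.2.1), h4, sub_self]

/-- The `m`-th derivative is tested against `φ'` and the `(m + 1)`-st against `φ`; the common sign
cancels. Derivatives of `u` given separately thereby form a tower of first derivatives. -/
theorem IsWeakDeriv.tower {m : ℕ} {u v w : ℝ → E} (h1 : IsWeakDeriv a b m u v)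
    (h2 : IsWeakDeriv a b (m + 1) u w) : IsWeakDeriv a b 1 v w := by
  refine ⟨h1.2.1, h2.2.1, fun φ a1 a2 a3 => ?_⟩
  have hφ : IsTest a b φ := ⟨a1, a2, a3⟩
  have e1 := h1.2.2 _ hφ.deriv.smooth hφ.deriv.compact hφ.deriv.subset
  have e2 := h2.2.2 φ a1 a2 a3
  rw [← iteratedDeriv_succ', e2, pow_succ, mul_smul] at e1
  rw [iteratedDeriv_one, pow_one]
  have h3 : ((-1 : ℝ) ^ m) ≠ 0 := by simp
  exact (smul_right_injective _ h3 e1).symm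

/-- Continuous functions with a continuous weak derivative are differentiable. -/
theorem IsWeakDeriv.hasDerivWithinAt [CompleteSpace E] (hab : a < b) {u v : ℝ → E}
    (h : IsWeakDeriv a b 1 u v) (hu : ContinuousOn u (Icc a b)) (hv : ContinuousOn v (Icc a b)) :
    ∀ t ∈ Icc a b, HasDerivWithinAt u (v t) (Icc a b) t := by
  set v' : ℝ → E := IccExtend hab.le ((Icc a b).domRestrict v) with hv'
  have hvc : Continuous v' := hv.domRestrict.Icc_extend'
  have hvv : ∀ t ∈ Icc a b, v' t = v t := fun t ht => by
    rw [hv', IccExtend_of_mem _ _ ht]; rfl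
  set W : ℝ → E := fun t => ∫ s in a..t, v' s
  have hW : ∀ t, HasDerivAt W (v' t) t := fun t =>
    intervalIntegral.integral_hasDerivAt_right (hvc.intervalIntegrable _ _)
      (hvc.stronglyMeasurableAtFilter _ _) hvc.continuousAt
  have hWc : Continuous W := continuous_iff_continuousAt.2 fun t => (hW t).continuousAt
  -- The difference between `u` and the primitive `W` of `v` has zero weak derivative. Continuity
  -- then extends the equality `u - W = c` from almost every point to the closed interval.
  obtain ⟨c, hc⟩ := exists_ae_eq_const (a := a) (b := b) (u := fun t => u t - W t) hab
    (h.1.sub (hWc.locallyIntegrable.locallyIntegrableOn _)) (fun φ hφ => by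
      have h1 := h.2.2 φ hφ.smooth hφ.compact hφ.subset
      rw [iteratedDeriv_one, pow_one] at h1
      have i1 := integrableOn_test_smul hφ.deriv (hWc.locallyIntegrable.locallyIntegrableOn (Ioo a b))
      have i2 := integrableOn_test_smul hφ (hvc.locallyIntegrable.locallyIntegrableOn (Ioo a b))
      have h2 := intervalIntegral.integral_eq_sub_of_hasDerivAt (a := a) (b := b)
        (f := fun y => φ y • W y) (f' := fun y => φ y • v' y + deriv φ y • W y)
        (fun y _ => ((hφ.smooth.differentiable (by simp)) y).hasDerivAt.smul (hW y))
        (((hφ.smooth.continuous.smul hvc).add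
          (hφ.deriv.smooth.continuous.smul hWc)).intervalIntegrable _ _)
      rw [intervalIntegral.integral_of_le hab.le, integral_Ioc_eq_integral_Ioo,
        integral_add i2 i1, hφ.eq_zero (x := a) (by simp), hφ.eq_zero (x := b) (by simp),
        zero_smul, zero_smul, sub_zero] at h2
      have h3 : ∫ y in Ioo a b, φ y • v' y = ∫ y in Ioo a b, φ y • v y :=
        setIntegral_congr_fun measurableSet_Ioo fun y hy => by
          simp only [hvv y (Ioo_subset_Icc_self hy)]
      simp only [smul_sub]
      rw [integral_sub (integrableOn_test_smul hφ.deriv h.1) i1, h1, ← h3, neg_one_smul,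
        ← neg_add', h2, neg_zero])
  have hEq : EqOn (fun t => u t - W t) (fun _ => c) (Icc a b) :=
    Measure.eqOn_Icc_of_ae_eq volume hab.ne (by rwa [← restrict_Ioo_eq_restrict_Icc])
      (hu.sub hWc.continuousOn) continuousOn_const
  intro t ht
  have := ((hW t).const_add c).hasDerivWithinAt (s := Icc a b)
  rw [hvv t ht] at this
  exact this.congr (fun x hx => sub_eq_iff_eq_add.1 (hEq hx)) (sub_eq_iff_eq_add.1 (hEq ht))

end BochnerValued

/-! ### Weak derivatives in `L₂(I)` -/

section SpaceWeakDeriv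

variable {R : ℝ} [hR : Fact (0 < R)]

/-- Pairing with a continuous function is a bounded functional on `L₂(I)`, here the value at `R` of
the primitive of the product. Weak identities thus survive limits and commute with integrals and
derivatives in `t`. -/
theorem exists_pairing (φ : ℝ → ℝ) (hφ : Continuous φ) :
    ∃ ℓ : L2 R →L[ℝ] ℝ, ∀ v, ℓ v = ∫ y in Ioo 0 R, φ y • v y := by
  let w : CI R := ⟨fun x => φ x, by fun_prop⟩
  refine ⟨(ContinuousMap.evalCLM ℝ ⟨R, right_mem_Icc.2 hR.out.le⟩).comp (primL.comp (mulL w)),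
    fun v => ?_⟩
  change primL (mulL w v) _ = _
  rw [primL_apply, intervalIntegral.integral_of_le hR.out.le, integral_Ioc_eq_integral_Ioo]
  refine integral_congr_ae ?_
  filter_upwards [mulL_ae w v, ae_restrict_mem measurableSet_Ioo] with x hx hx'
  rw [hx, extendL_apply _ (Ioo_subset_Icc_self hx')]
  rfl

omit hR in
theorem isWeakDeriv_L2_iff {m : ℕ} {u v : L2 R} :
    IsWeakDeriv 0 R m u v ↔ ∀ φ, IsTest 0 R φ →
      ∫ y in Ioo 0 R, iteratedDeriv m φ y • u y = (-1 : ℝ) ^ m • ∫ y in Ioo 0 R, φ y • v y :=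
  ⟨fun h φ hφ => h.2.2 φ hφ.smooth hφ.compact hφ.subset, fun h =>
    ⟨IntegrableOn.locallyIntegrableOn (integrable_coe u),
      IntegrableOn.locallyIntegrableOn (integrable_coe v), fun φ h1 h2 h3 => h φ ⟨h1, h2, h3⟩⟩⟩

omit hR in
theorem isWeakDeriv_zero_iff {u v : L2 R} : IsWeakDeriv 0 R 0 u v ↔ u = v := by
  refine ⟨fun h => Lp.ext h.ae_eq_of_zero, ?_⟩
  rintro rfl
  exact isWeakDeriv_L2_iff.2 fun φ _ => by simp

theorem isClosed_setOf_isWeakDeriv (m : ℕ) :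
    IsClosed {p : L2 R × L2 R | IsWeakDeriv 0 R m p.1 p.2} := by
  simp only [isWeakDeriv_L2_iff, ofPred_forall]
  refine isClosed_iInter fun φ => isClosed_iInter fun hφ => ?_
  obtain ⟨ℓ, hℓ⟩ := exists_pairing (R := R) _ (hφ.iteratedDeriv m).smooth.continuous
  obtain ⟨ℓ', hℓ'⟩ := exists_pairing (R := R) _ hφ.smooth.continuous
  simp only [← hℓ, ← hℓ']
  exact isClosed_eq (by fun_prop) (by fun_prop)

/-- The relation is closed in `L₂ × L₂`, so by density `v` may be taken continuous, where
integration by parts applies. -/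
theorem isWeakDeriv_const_add_prim (c : ℝ) (v : L2 R) :
    IsWeakDeriv 0 R 1 (embL (constL c + primL v)) v := by
  refine denseRange_embL.induction_on
    (p := fun v => IsWeakDeriv 0 R 1 (embL (constL c + primL v)) v) v ?_ ?_
  · exact (isClosed_setOf_isWeakDeriv 1).preimage
      (f := fun v : L2 R => ((embL (constL c + primL v), v) : L2 R × L2 R)) (by fun_prop)
  intro h
  rw [isWeakDeriv_L2_iff]
  intro φ hφ
  set w : CI R := constL c + primL (embL h) with hw
  have hd : ∀ y ∈ Ioo 0 R, HasDerivAt (extendL w) (extendL h y) y := fun y hy =>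
    ((hasDerivAt_primL_embL h hy).const_add c).congr_of_eventuallyEq
      (Eventually.of_forall fun z => by
        rw [hw, map_add]
        change constL c _ + _ = _
        rw [constL_apply])
  have h2 := intervalIntegral.integral_eq_sub_of_hasDerivAt_of_le hR.out.le
    (f := fun y => φ y • extendL w y) (f' := fun y => φ y • extendL h y + deriv φ y • extendL w y)
    (hφ.smooth.continuous.smul (extendL w).continuous).continuousOn
    (fun y hy => ((hφ.smooth.differentiable (by simp)) y).hasDerivAt.smul (hd y hy))
    (((hφ.smooth.continuous.smul (extendL h).continuous).add
      (hφ.deriv.smooth.continuous.smul (extendL w).continuous)).intervalIntegrable _ _)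
  have i1 := integrableOn_test_smul hφ.deriv
    ((extendL w).continuous.locallyIntegrable.locallyIntegrableOn (Ioo 0 R))
  have i2 := integrableOn_test_smul hφ
    ((extendL h).continuous.locallyIntegrable.locallyIntegrableOn (Ioo 0 R))
  rw [intervalIntegral.integral_of_le hR.out.le, integral_Ioc_eq_integral_Ioo,
    integral_add i2 i1, hφ.eq_zero (x := 0) (by simp), hφ.eq_zero (x := R) (by simp),
    zero_smul, zero_smul, sub_zero] at h2
  have e1 : ∫ y in Ioo 0 R, iteratedDeriv 1 φ y • (embL w) y =
      ∫ y in Ioo 0 R, deriv φ y • extendL w y := by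
    refine integral_congr_ae ?_
    filter_upwards [embL_ae w] with y hy
    rw [hy, iteratedDeriv_one]
  have e2 : ∫ y in Ioo 0 R, φ y • (embL h) y = ∫ y in Ioo 0 R, φ y • extendL h y := by
    refine integral_congr_ae ?_
    filter_upwards [embL_ae h] with y hy
    rw [hy]
  rw [e1, e2, pow_one, neg_one_smul]
  linarith

omit hR in
theorem IsWeakDeriv.succ_of_L2 {m : ℕ} {u v w : L2 R} (h1 : IsWeakDeriv 0 R 1 u v)
    (h2 : IsWeakDeriv 0 R m v w) : IsWeakDeriv 0 R (m + 1) u w := by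
  rw [isWeakDeriv_L2_iff] at *
  intro φ hφ
  have e1 := h1 _ (hφ.iteratedDeriv m)
  rw [iteratedDeriv_one, ← iteratedDeriv_succ, h2 φ hφ] at e1
  rw [e1, pow_one, pow_succ, mul_smul, smul_comm]

omit hR in
theorem IsWeakDeriv.of_succ_of_L2 {m : ℕ} {u v w : L2 R} (h1 : IsWeakDeriv 0 R 1 u v)
    (h2 : IsWeakDeriv 0 R (m + 1) u w) : IsWeakDeriv 0 R m v w := by
  rw [isWeakDeriv_L2_iff] at *
  intro φ hφ
  have e1 := h1 _ (hφ.iteratedDeriv m)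
  rw [iteratedDeriv_one, ← iteratedDeriv_succ, h2 φ hφ, pow_one, pow_succ, mul_smul] at e1
  simp only [neg_smul, one_smul, smul_neg, neg_inj] at e1
  exact e1.symm

/-- A weak derivative of order `m + 1` in `L₂(I)` can be integrated to a weak derivative of
order `m`. -/
theorem exists_lowering (m : ℕ) : ∃ c : L2 R × L2 R →L[ℝ] ℝ, ∀ u s : L2 R,
    IsWeakDeriv 0 R (m + 1) u s → IsWeakDeriv 0 R m u (embL (constL (c (u, s)) + primL s)) := by
  obtain ⟨θ, hθ, hθ1⟩ := exists_isTest_integral_eq_one hR.out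
  obtain ⟨ℓ, hℓ⟩ := exists_pairing (R := R) _ (hθ.iteratedDeriv m).smooth.continuous
  obtain ⟨ℓ', hℓ'⟩ := exists_pairing (R := R) _ hθ.smooth.continuous
  -- The constant is dictated by testing with `θ`: since `∫ θ = 1`, it equals `(-1)ᵐ ∫ θ⁽ᵐ⁾ u - ∫ θ
  -- ∫₀ˣ s`, which is linear and continuous in `(u, s)`.
  refine ⟨((-1 : ℝ) ^ m) • ℓ.comp (ContinuousLinearMap.fst ℝ _ _) -
    (ℓ'.comp (embL.comp primL)).comp (ContinuousLinearMap.snd ℝ _ _), fun u s h => ?_⟩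
  rw [isWeakDeriv_L2_iff] at h ⊢
  change ∀ φ, IsTest 0 R φ → ∫ y in Ioo 0 R, iteratedDeriv m φ y • u y = (-1 : ℝ) ^ m • ∫ y in
    Ioo 0 R, φ y • (embL (constL ((-1 : ℝ) ^ m * ℓ u - ℓ' (embL (primL s))) + primL s) : L2 R) y
  intro φ hφ
  set c : ℝ := (-1 : ℝ) ^ m * ℓ u - ℓ' (embL (primL s)) with hc
  set d := ∫ y in Ioo 0 R, φ y with hd
  obtain ⟨ψ, hψ, hψd⟩ := (hφ.sub (hθ.const_mul d)).exists_primitive (by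
    rw [integral_sub hφ.integrableOn (hθ.const_mul d).integrableOn, integral_const_mul, hθ1]
    ring)
  obtain ⟨p, hp⟩ := exists_pairing (R := R) _ (hφ.iteratedDeriv m).smooth.continuous
  obtain ⟨p', hp'⟩ := exists_pairing (R := R) _ hφ.smooth.continuous
  obtain ⟨q, hq⟩ := exists_pairing (R := R) _ hψ.smooth.continuous
  have hw := isWeakDeriv_L2_iff.1 (isWeakDeriv_const_add_prim 0 s) ψ hψ
  have hs := h ψ hψ
  have hconst : p' (embL (constL c)) = c * d := by
    rw [hp', hd, ← integral_const_mul]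
    refine integral_congr_ae ?_
    filter_upwards [embL_ae (constL (R := R) c)] with y hy
    rw [hy, smul_eq_mul, mul_comm]
    congr 1
    exact constL_apply c _
  have lin : ∀ (j : ℕ) (v : L2 R), ∫ y in Ioo 0 R, iteratedDeriv (j + 1) ψ y • v y =
      (∫ y in Ioo 0 R, iteratedDeriv j φ y • v y) -
        d * ∫ y in Ioo 0 R, iteratedDeriv j θ y • v y := by
    intro j v
    rw [← integral_const_mul, ← integral_sub
      (integrable_test R v _ (hφ.iteratedDeriv j).smooth.continuous (hφ.iteratedDeriv j).compact)
      ((integrable_test R v _ (hθ.iteratedDeriv j).smooth.continuous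
        (hθ.iteratedDeriv j).compact).const_mul d)]
    congr 1
    ext y
    rw [iteratedDeriv_succ', hψd, iteratedDeriv_fun_sub, iteratedDeriv_const_mul_field]
    · simp only [smul_eq_mul]
      ring
    · exact (hφ.smooth.of_le (by exact_mod_cast le_top)).contDiffAt
    · exact ((hθ.const_mul d).smooth.of_le (by exact_mod_cast le_top)).contDiffAt
  rw [lin m, ← hp, ← hℓ, ← hq] at hs
  rw [show (1 : ℕ) = 0 + 1 from rfl, lin 0] at hw
  simp only [iteratedDeriv_zero, map_zero, zero_add] at hw
  rw [← hp', ← hℓ', ← hq] at hw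
  rw [← hp, ← hp', map_add, map_add, hconst, hc]
  simp only [smul_eq_mul, pow_succ] at *
  have h1 : ((-1 : ℝ) ^ m) * ((-1 : ℝ) ^ m) = 1 := by
    rw [← mul_pow]; simp
  linear_combination hs - (-1 : ℝ) ^ m * hw - d * ℓ u * h1

end SpaceWeakDeriv

/-! ### The Sobolev spaces `Hⁿ(I)` -/

section Sobolev

variable {R : ℝ}

/-- The embedding of `Hⁿ(I)` into `L₂(I)`. -/
def iota (n : ℕ) : H R n →L[ℝ] L2 R :=
  (PiLp.proj (𝕜 := ℝ) 2 (fun _ : Fin (n + 1) => L2 R) 0).comp (H R n).subtypeL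

theorem iota_apply (n : ℕ) (V : H R n) : iota n V = V.1 0 := rfl

theorem IsWeakDeriv.unique_of_L2 {m : ℕ} {u v w : L2 R} (h1 : IsWeakDeriv 0 R m u v)
    (h2 : IsWeakDeriv 0 R m u w) : v = w := by
  refine isWeakDeriv_zero_iff.1 (isWeakDeriv_L2_iff.2 fun φ hφ => ?_)
  rw [isWeakDeriv_L2_iff] at h1 h2
  have h3 : ((-1 : ℝ) ^ m) ≠ 0 := by simp
  simpa using smul_right_injective ℝ h3 ((h1 φ hφ).symm.trans (h2 φ hφ))

/-- Weak derivatives are unique, so the zeroth component determines the tuple. Identities between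
`Hⁿ(I)`-valued curves can therefore be checked in `L₂(I)`. -/
theorem iota_injective (n : ℕ) : Function.Injective (iota (R := R) n) := by
  intro V W h
  refine Subtype.ext (PiLp.ext fun j => (V.2 j).unique_of_L2 ?_)
  have := W.2 j
  rw [iota_apply, iota_apply] at h
  rwa [← h] at this

theorem mem_H_succ {n : ℕ} {V : PiLp 2 (fun _ : Fin (n + 1 + 1) => L2 R)}
    (h : IsWeakDeriv 0 R 1 (V 0) (V 1)) (h' : ∀ j : Fin (n + 1), IsWeakDeriv 0 R j (V 1) (V j.succ)) :
    V ∈ H R (n + 1) := by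
  intro j
  refine Fin.cases ?_ (fun i => ?_) j
  · exact isWeakDeriv_zero_iff.2 rfl
  · exact h.succ_of_L2 (h' i)

/-- The derivative as an operator `Hⁿ⁺¹(I) → Hⁿ(I)`. -/
def der (n : ℕ) : H R (n + 1) →L[ℝ] H R n :=
  ContinuousLinearMap.codRestrict
    (((PiLp.continuousLinearEquiv 2 ℝ (fun _ : Fin (n + 1) => L2 R)).symm :
        (Fin (n + 1) → L2 R) →L[ℝ] PiLp 2 (fun _ : Fin (n + 1) => L2 R)).comp
      (ContinuousLinearMap.pi fun j : Fin (n + 1) =>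
        (PiLp.proj (𝕜 := ℝ) 2 (fun _ : Fin (n + 1 + 1) => L2 R) j.succ).comp (H R (n + 1)).subtypeL))
    (H R n) (fun V j => (V.2 1).of_succ_of_L2 (V.2 j.succ))

theorem isWeakDeriv_der {n : ℕ} (V : H R (n + 1)) :
    IsWeakDeriv 0 R 1 (iota (n + 1) V) (iota n (der n V)) := V.2 1

/-- The embedding `Hᵐ(I) → Hⁿ(I)`, `n ≤ m`. -/
def incl {n m : ℕ} (h : n ≤ m) : H R m →L[ℝ] H R n :=
  ContinuousLinearMap.codRestrict
    (((PiLp.continuousLinearEquiv 2 ℝ (fun _ : Fin (n + 1) => L2 R)).symm :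
        (Fin (n + 1) → L2 R) →L[ℝ] PiLp 2 (fun _ : Fin (n + 1) => L2 R)).comp
      (ContinuousLinearMap.pi fun j : Fin (n + 1) =>
        (PiLp.proj (𝕜 := ℝ) 2 (fun _ : Fin (m + 1) => L2 R)
          (j.castLE (Nat.succ_le_succ h))).comp (H R m).subtypeL))
    (H R n) (fun V j => V.2 (j.castLE (Nat.succ_le_succ h)))

/-- The identification of `L₂(I)` with `H⁰(I)`. -/
def ofL2 : L2 R →L[ℝ] H R 0 :=
  ContinuousLinearMap.codRestrict
    (((PiLp.continuousLinearEquiv 2 ℝ (fun _ : Fin (0 + 1) => L2 R)).symm :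
        (Fin (0 + 1) → L2 R) →L[ℝ] PiLp 2 (fun _ : Fin (0 + 1) => L2 R)).comp
      (ContinuousLinearMap.pi fun _ : Fin (0 + 1) => ContinuousLinearMap.id ℝ (L2 R)))
    (H R 0) (fun V j => by
      obtain rfl : j = 0 := Fin.fin_one_eq_zero j
      exact isWeakDeriv_zero_iff.2 rfl)

variable [hR : Fact (0 < R)]

instance completeSpace_H (n : ℕ) : CompleteSpace (H R n) := by
  have h : (H R n : Set (PiLp 2 fun _ : Fin (n + 1) => L2 R)) =
      ⋂ j : Fin (n + 1), {V | IsWeakDeriv 0 R j (V 0) (V j)} := by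
    ext V
    simp only [mem_iInter]
    rfl
  have hc : IsClosed (H R n : Set (PiLp 2 fun _ : Fin (n + 1) => L2 R)) := by
    rw [h]
    exact isClosed_iInter fun j => (isClosed_setOf_isWeakDeriv (R := R) j).preimage
      (f := fun V : PiLp 2 fun _ : Fin (n + 1) => L2 R => (V 0, V j)) (by fun_prop)
  exact hc.completeSpace_coe

/-- The components of the function with prescribed value at `0` and prescribed derivative in
`Hⁿ(I)`. -/
def integFun (n : ℕ) : ℝ × H R n →L[ℝ] PiLp 2 (fun _ : Fin (n + 1 + 1) => L2 R) :=
  ((PiLp.continuousLinearEquiv 2 ℝ (fun _ : Fin (n + 1 + 1) => L2 R)).symm :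
      (Fin (n + 1 + 1) → L2 R) →L[ℝ] PiLp 2 (fun _ : Fin (n + 1 + 1) => L2 R)).comp
    (ContinuousLinearMap.pi (Fin.cons
      (embL.comp ((constL.comp (ContinuousLinearMap.fst ℝ ℝ (H R n))) +
        primL.comp ((iota n).comp (ContinuousLinearMap.snd ℝ ℝ (H R n)))))
      (fun i => ((PiLp.proj (𝕜 := ℝ) 2 (fun _ : Fin (n + 1) => L2 R) i).comp
        (H R n).subtypeL).comp (ContinuousLinearMap.snd ℝ ℝ (H R n)))))

theorem integFun_zero (n : ℕ) (p : ℝ × H R n) :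
    integFun n p 0 = embL (constL p.1 + primL (iota n p.2)) := rfl

theorem integFun_succ (n : ℕ) (p : ℝ × H R n) (i : Fin (n + 1)) :
    integFun n p i.succ = p.2.1 i := rfl

theorem integFun_mem (n : ℕ) (p : ℝ × H R n) : integFun n p ∈ H R (n + 1) := by
  have h1 : integFun n p 1 = p.2.1 0 := integFun_succ n p 0
  refine mem_H_succ ?_ fun j => ?_
  · rw [integFun_zero, h1]
    exact isWeakDeriv_const_add_prim p.1 (iota n p.2)
  · rw [h1, integFun_succ]
    exact p.2.2 j

/-- The function with prescribed value at `0` and prescribed derivative in `Hⁿ(I)`. -/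
def integ (n : ℕ) : ℝ × H R n →L[ℝ] H R (n + 1) :=
  (integFun n).codRestrict (H R (n + 1)) (integFun_mem n)

theorem iota_integ (n : ℕ) (c : ℝ) (V : H R n) :
    iota (n + 1) (integ n (c, V)) = embL (constL c + primL (iota n V)) :=
  integFun_zero n (c, V)

/-- A function in `L₂(I)` whose `m`-th weak derivative is in `Hⁿ(I)` belongs to `Hⁿ⁺ᵐ(I)`,
with linear and continuous dependence. -/
theorem exists_lift (m : ℕ) : ∀ n N : ℕ, N = n + m → ∃ Λ : L2 R × H R n →L[ℝ] H R N,
    ∀ (u : L2 R) (S : H R n), IsWeakDeriv 0 R m u (iota n S) → iota N (Λ (u, S)) = u := by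
  induction m with
  | zero =>
    rintro n N rfl
    exact ⟨ContinuousLinearMap.snd ℝ _ _, fun u S h => (isWeakDeriv_zero_iff.1 h).symm⟩
  | succ m ih =>
    intro n N hN
    obtain ⟨c, hc⟩ := exists_lowering (R := R) m
    obtain ⟨Λ, hΛ⟩ := ih (n + 1) N (by omega)
    let A : L2 R × H R n →L[ℝ] ℝ := c.comp ((ContinuousLinearMap.fst ℝ _ _).prod
      ((iota n).comp (ContinuousLinearMap.snd ℝ _ _)))
    refine ⟨Λ.comp ((ContinuousLinearMap.fst ℝ _ _).prod
      ((integ n).comp (A.prod (ContinuousLinearMap.snd ℝ _ _)))), fun u S h => hΛ u _ ?_⟩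
    exact hc u (iota n S) h

/-- The trace at `0` is a bounded functional on `Hⁿ⁺¹(I)`; this is `exists_lowering` for `m = 0`. -/
theorem exists_initial_value (n : ℕ) : ∃ c : H R (n + 1) →L[ℝ] ℝ, ∀ V,
    iota (n + 1) V = embL (constL (c V) + primL (iota n (der n V))) := by
  obtain ⟨c, hc⟩ := exists_lowering (R := R) 0
  refine ⟨c.comp ((iota (n + 1)).prod ((iota n).comp (der n))), fun V => ?_⟩
  exact isWeakDeriv_zero_iff.1 (hc _ _ (isWeakDeriv_der V))

theorem embL_injective : Function.Injective (embL (R := R)) := by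
  intro w z h
  have h1 : extendL w =ᵐ[volume.restrict (Ioo (0 : ℝ) R)] extendL z :=
    (embL_ae w).symm.trans ((by rw [h] : _ =ᵐ[_] _).trans (embL_ae z))
  rw [restrict_Ioo_eq_restrict_Icc] at h1
  have h2 := Measure.eqOn_Icc_of_ae_eq volume hR.out.ne h1
    (extendL w).continuous.continuousOn (extendL z).continuous.continuousOn
  ext x
  have := h2 x.2
  rwa [extendL_apply w x.2, extendL_apply z x.2] at this

end Sobolev

/-! ### The classes `C^M([0, T]; Hⁿ(I))` -/

section Smooth

variable {R : ℝ}

/-- `v ∈ C^M([0, T]; Hⁿ(I))`. -/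
def SmoothInto (T : ℝ) (M n : ℕ) (v : ℝ → L2 R) : Prop :=
  ∃ V : ℝ → H R n, ContDiffOn ℝ M V (Icc 0 T) ∧ ∀ t ∈ Icc 0 T, v t = iota n (V t)

variable {T : ℝ} {M n : ℕ}

theorem SmoothInto.contDiffOn {v : ℝ → L2 R} (h : SmoothInto T M n v) :
    ContDiffOn ℝ M v (Icc 0 T) := by
  obtain ⟨V, hV, e⟩ := h
  exact ((iota n).contDiff.comp_contDiffOn hV).congr e

theorem smoothInto_zero_iff {v : ℝ → L2 R} :
    SmoothInto T M 0 v ↔ ContDiffOn ℝ M v (Icc 0 T) :=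
  ⟨SmoothInto.contDiffOn, fun h =>
    ⟨fun t => ofL2 (v t), ofL2.contDiff.comp_contDiffOn h, fun _ _ => rfl⟩⟩

theorem SmoothInto.mono {v : ℝ → L2 R} (h : SmoothInto T M n v) {n' : ℕ} (hn : n' ≤ n) :
    SmoothInto T M n' v := by
  obtain ⟨V, hV, e⟩ := h
  exact ⟨fun t => incl hn (V t), (incl hn).contDiff.comp_contDiffOn hV, e⟩

theorem SmoothInto.congr {v w : ℝ → L2 R} (h : SmoothInto T M n v)
    (hw : ∀ t ∈ Icc 0 T, w t = v t) : SmoothInto T M n w := by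
  obtain ⟨V, hV, e⟩ := h
  exact ⟨V, hV, fun t ht => (hw t ht).trans (e t ht)⟩

theorem SmoothInto.add {v w : ℝ → L2 R} (h : SmoothInto T M n v) (h' : SmoothInto T M n w) :
    SmoothInto T M n (fun t => v t + w t) := by
  obtain ⟨V, hV, e⟩ := h
  obtain ⟨W, hW, e'⟩ := h'
  exact ⟨fun t => V t + W t, hV.add hW, fun t ht => by simp only [e t ht, e' t ht, map_add]⟩

theorem SmoothInto.const_smul {v : ℝ → L2 R} (h : SmoothInto T M n v) (b : ℝ) :
    SmoothInto T M n (fun t => b • v t) := by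
  obtain ⟨V, hV, e⟩ := h
  exact ⟨fun t => b • V t, hV.const_smul b, fun t ht => by simp only [e t ht, map_smul]⟩

variable [hR : Fact (0 < R)]

/-- A curve of continuous functions which is in `C^M([0, T]; Hⁿ⁺¹(I))`. -/
def SmoothC (T : ℝ) (M n : ℕ) (w : ℝ → CI R) : Prop :=
  ∃ (c : ℝ → ℝ) (v : ℝ → L2 R), ContDiffOn ℝ M c (Icc 0 T) ∧ SmoothInto T M n v ∧
    ∀ t ∈ Icc 0 T, w t = constL (c t) + primL (v t)

theorem SmoothC.contDiffOn {w : ℝ → CI R} (h : SmoothC T M n w) :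
    ContDiffOn ℝ M w (Icc 0 T) := by
  obtain ⟨c, v, hc, hv, e⟩ := h
  exact ((constL.contDiff.comp_contDiffOn hc).add
    (primL.contDiff.comp_contDiffOn hv.contDiffOn)).congr e

theorem SmoothC.smoothInto {w : ℝ → CI R} (h : SmoothC T M n w) :
    SmoothInto T M (n + 1) (fun t => embL (w t)) := by
  obtain ⟨c, v, hc, ⟨V, hV, e'⟩, e⟩ := h
  refine ⟨fun t => integ n (c t, V t), (integ n).contDiff.comp_contDiffOn (hc.prodMk hV), ?_⟩
  intro t ht
  simp only [iota_integ, e t ht, e' t ht]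

theorem SmoothInto.exists_smoothC {v : ℝ → L2 R} (h : SmoothInto T M (n + 1) v) :
    ∃ w, SmoothC T M n w ∧ ∀ t ∈ Icc 0 T, v t = embL (w t) := by
  obtain ⟨V, hV, e⟩ := h
  obtain ⟨c, hc⟩ := exists_initial_value (R := R) n
  refine ⟨fun t => constL (c (V t)) + primL (iota n (der n (V t))),
    ⟨_, _, c.contDiff.comp_contDiffOn hV, ⟨fun t => der n (V t), (der n).contDiff.comp_contDiffOn hV,
      fun _ _ => rfl⟩, fun _ _ => rfl⟩, fun t ht => by rw [e t ht, hc]⟩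

theorem SmoothC.mono {w : ℝ → CI R} (h : SmoothC T M n w) {n' : ℕ} (hn : n' ≤ n) :
    SmoothC T M n' w := by
  obtain ⟨c, v, hc, hv, e⟩ := h
  exact ⟨c, v, hc, hv.mono hn, e⟩

theorem SmoothC.congr {w z : ℝ → CI R} (h : SmoothC T M n w)
    (hz : ∀ t ∈ Icc 0 T, z t = w t) : SmoothC T M n z := by
  obtain ⟨c, v, hc, hv, e⟩ := h
  exact ⟨c, v, hc, hv, fun t ht => (hz t ht).trans (e t ht)⟩

theorem smoothInto_mulL_zero {w : ℝ → CI R} {v : ℝ → L2 R} (hw : ContDiffOn ℝ M w (Icc 0 T))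
    (hv : SmoothInto T M 0 v) : SmoothInto T M 0 (fun t => mulL (w t) (v t)) :=
  smoothInto_zero_iff.2 ((mulL.contDiff.comp_contDiffOn hw).clm_apply hv.contDiffOn)

/-- Products in `Hⁿ⁺¹` need multiplication on `Hⁿ`, which itself is a product one level down. Taking
the latter as the hypothesis `H` separates the two halves of this recursion. -/
theorem SmoothC.mul_of {w z : ℝ → CI R} (hw : SmoothC T M n w) (hz : SmoothC T M n z)
    (H : ∀ (w : ℝ → CI R) (v : ℝ → L2 R), SmoothC T M n w → SmoothInto T M n v →
      SmoothInto T M n (fun t => mulL (w t) (v t))) :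
    SmoothC T M n (fun t => w t * z t) := by
  obtain ⟨c, p, hc, hp, e1⟩ := id hw
  obtain ⟨d, q, hd, hq, e2⟩ := id hz
  refine ⟨fun t => c t * d t, fun t => mulL (w t) (q t) + mulL (z t) (p t), hc.mul hd,
    (H _ _ hw hq).add (H _ _ hz hp), fun t ht => ?_⟩
  simp only [e1 t ht, e2 t ht, const_add_prim_mul]

theorem SmoothC.smoothInto_mulL {w : ℝ → CI R} {v : ℝ → L2 R} (hw : SmoothC T M n w)
    (hv : SmoothInto T M n v) : SmoothInto T M n (fun t => mulL (w t) (v t)) := by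
  induction n generalizing w v with
  | zero => exact smoothInto_mulL_zero hw.contDiffOn hv
  | succ n ih =>
    obtain ⟨z, hz, e⟩ := hv.exists_smoothC
    refine ((hw.mono n.le_succ).mul_of hz fun _ _ => ih).smoothInto.congr fun t ht => ?_
    rw [e t ht, mulL_embL]

theorem SmoothC.mul {w z : ℝ → CI R} (hw : SmoothC T M n w) (hz : SmoothC T M n z) :
    SmoothC T M n (fun t => w t * z t) :=
  hw.mul_of hz fun _ _ => SmoothC.smoothInto_mulL

/-- By the chain rule the derivative of `g(w)` in `x` is `g'(w) v`, so each order in `x` costs one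
derivative of `g`. At `n = 0` only `g'(w) ∈ C^M([0,T]; C[0,R])` is needed, which costs `M`
derivatives of `g'`. -/
theorem SmoothC.nemytskii {w : ℝ → CI R} (hw : SmoothC T M n w) (g : C(ℝ, ℝ))
    (hg : ContDiff ℝ (M + n + 1 : ℕ) g) : SmoothC T M n (fun t => nemytskii g (w t)) := by
  induction n generalizing g with
  | zero =>
    obtain ⟨c, v, hc, hv, e⟩ := id hw
    have hg' : ContDiff ℝ M (deriv g) := (contDiff_succ_iff_deriv.1 hg).2.2
    refine ⟨fun t => g (c t), fun t => mulL (GKdV.nemytskii ⟨deriv g, hg'.continuous⟩ (w t)) (v t),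
      (hg.of_le (by exact_mod_cast (by omega))).comp_contDiffOn hc, smoothInto_mulL_zero
        ((contDiff_nemytskii M ⟨deriv g, hg'.continuous⟩ hg').comp_contDiffOn hw.contDiffOn) hv,
      fun t ht => ?_⟩
    simp only [e t ht]
    exact nemytskii_const_add_prim g ⟨deriv g, hg'.continuous⟩
      (fun x => (hg.differentiable (by simp) x).hasDerivAt) _ _
  | succ n ih =>
    obtain ⟨c, v, hc, hv, e⟩ := id hw
    have hg' : ContDiff ℝ (M + n + 1 : ℕ) (deriv g) := (contDiff_succ_iff_deriv.1 hg).2.2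
    have h1 := ih (hw.mono n.le_succ) ⟨deriv g, hg'.continuous⟩ hg'
    refine ⟨fun t => g (c t), fun t => mulL (GKdV.nemytskii ⟨deriv g, hg'.continuous⟩ (w t)) (v t),
      (hg.of_le (by exact_mod_cast (by omega))).comp_contDiffOn hc, ?_, fun t ht => ?_⟩
    · obtain ⟨z, hz, e'⟩ := hv.exists_smoothC
      refine (h1.mul hz).smoothInto.congr fun t ht => ?_
      rw [e' t ht, mulL_embL]
    simp only [e t ht]
    exact nemytskii_const_add_prim g ⟨deriv g, hg'.continuous⟩
      (fun x => (hg.differentiable (by simp) x).hasDerivAt) _ _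

end Smooth

/-! ### Derivatives in time -/

section Time

variable {E : Type*} [NormedAddCommGroup E] [NormedSpace ℝ E] {T : ℝ}

theorem eqOn_of_hasDerivWithinAt {f g f' : ℝ → E}
    (hf : ∀ t ∈ Icc 0 T, HasDerivWithinAt f (f' t) (Icc 0 T) t)
    (hg : ∀ t ∈ Icc 0 T, HasDerivWithinAt g (f' t) (Icc 0 T) t) (h0 : f 0 = g 0) :
    EqOn f g (Icc 0 T) := by
  intro t ht
  have h := constant_of_has_deriv_right_zero (f := fun t => f t - g t) (a := 0) (b := T)
    (fun t ht => ((hf t ht).continuousWithinAt.sub (hg t ht).continuousWithinAt))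
    (fun x hx => by
      have h1 := ((hf x (Ico_subset_Icc_self hx)).sub (hg x (Ico_subset_Icc_self hx)))
      rw [sub_self] at h1
      exact h1.mono_of_mem_nhdsWithin (Icc_mem_nhdsGE_of_mem hx)) t ht
  simp only [h0, sub_self] at h
  exact sub_eq_zero.1 h

theorem exists_hasDerivWithinAt [CompleteSpace E] (hT : 0 < T) {f' : ℝ → E}
    (hf' : ContinuousOn f' (Icc 0 T)) (c : E) :
    ∃ f : ℝ → E, f 0 = c ∧ ∀ t ∈ Icc 0 T, HasDerivWithinAt f (f' t) (Icc 0 T) t := by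
  set v : ℝ → E := IccExtend hT.le ((Icc 0 T).domRestrict f') with hv
  have hvc : Continuous v := hf'.domRestrict.Icc_extend'
  refine ⟨fun t => c + ∫ s in (0 : ℝ)..t, v s, by simp, fun t ht => ?_⟩
  have h : HasDerivAt (fun t => ∫ s in (0 : ℝ)..t, v s) (v t) t :=
    intervalIntegral.integral_hasDerivAt_right (hvc.intervalIntegrable _ _)
      (hvc.stronglyMeasurableAtFilter _ _) hvc.continuousAt
  have e : v t = f' t := by
    rw [hv, IccExtend_of_mem _ _ ht]; rfl
  rw [e] at h
  exact (h.const_add c).hasDerivWithinAt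

theorem contDiffOn_of_tower (hT : 0 < T) {N : ℕ} {V : ℕ → ℝ → E}
    (hd : ∀ m < N, ∀ t ∈ Icc 0 T, HasDerivWithinAt (V m) (V (m + 1) t) (Icc 0 T) t)
    (hc : ContinuousOn (V N) (Icc 0 T)) : ContDiffOn ℝ N (V 0) (Icc 0 T) := by
  induction N generalizing V with
  | zero => exact contDiffOn_zero.2 hc
  | succ N ih =>
    rw [Nat.cast_succ, contDiffOn_succ_iff_derivWithin (uniqueDiffOn_Icc hT)]
    refine ⟨fun t ht => (hd 0 N.succ_pos t ht).differentiableWithinAt, by simp, ?_⟩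
    refine (ih (V := fun m => V (m + 1)) (fun m hm => hd (m + 1) (by omega)) hc).congr ?_
    exact fun t ht => (hd 0 N.succ_pos t ht).derivWithin (uniqueDiffOn_Icc hT t ht)

theorem iteratedDerivWithin_eq_of_tower (hT : 0 < T) {N : ℕ} {V : ℕ → ℝ → E}
    (hd : ∀ m < N, ∀ t ∈ Icc 0 T, HasDerivWithinAt (V m) (V (m + 1) t) (Icc 0 T) t) :
    ∀ m ≤ N, EqOn (iteratedDerivWithin m (V 0) (Icc 0 T)) (V m) (Icc 0 T) := by
  intro m
  induction m with
  | zero => intro _ t _; simp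
  | succ m ih =>
    intro hm t ht
    rw [iteratedDerivWithin_succ, derivWithin_congr (ih (by omega)) (ih (by omega) ht)]
    exact (hd m (by omega) t ht).derivWithin (uniqueDiffOn_Icc hT t ht)

theorem hasDerivWithinAt_iteratedDerivWithin (hT : 0 < T) {N : ℕ} {f : ℝ → E}
    (hf : ContDiffOn ℝ N f (Icc 0 T)) : ∀ m < N, ∀ t ∈ Icc 0 T,
    HasDerivWithinAt (iteratedDerivWithin m f (Icc 0 T))
      (iteratedDerivWithin (m + 1) f (Icc 0 T) t) (Icc 0 T) t := by
  intro m hm t ht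
  rw [iteratedDerivWithin_succ]
  exact (hf.differentiableOn_iteratedDerivWithin (by exact_mod_cast hm)
    (uniqueDiffOn_Icc hT) t ht).hasDerivWithinAt

omit [NormedSpace ℝ E] in
theorem memLp_Ioo_of_continuousOn {f : ℝ → E} (hf : ContinuousOn f (Icc 0 T)) :
    MemLp f 2 (volume.restrict (Ioo 0 T)) := by
  rw [restrict_Ioo_eq_restrict_Icc]
  obtain ⟨C, hC⟩ := isCompact_Icc.exists_bound_of_continuousOn hf
  exact MemLp.of_bound (hf.aestronglyMeasurable_of_isCompact isCompact_Icc measurableSet_Icc) C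
    ((ae_restrict_iff' measurableSet_Icc).2 (Eventually.of_forall hC))

end Time

/-! ### Curves in `Hⁿ(I)`: lifting from `L₂(I)` through derivatives in `x` and in `t`. -/

section Lift

variable {R T : ℝ} {n N : ℕ}

theorem memCH_iff_smoothInto {v : ℝ → L2 R} : MemCH R T n v ↔ SmoothInto T 0 n v := by
  constructor
  · rintro ⟨V, hV, e⟩
    exact ⟨V, contDiffOn_zero.2 hV, e⟩
  · rintro ⟨V, hV, e⟩
    exact ⟨V, hV.continuousOn, e⟩

theorem MemCH.memL2H {v : ℝ → L2 R} (h : MemCH R T n v) : MemL2H R T n v := by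
  obtain ⟨V, hV, e⟩ := h
  refine ⟨V, memLp_Ioo_of_continuousOn hV, ?_⟩
  filter_upwards [ae_restrict_mem measurableSet_Ioo] with t ht using e t (Ioo_subset_Icc_self ht)

theorem MemL2H.sub {v w : ℝ → L2 R} (h : MemL2H R T n v) (h' : MemL2H R T n w) :
    MemL2H R T n (fun t => v t - w t) := by
  obtain ⟨V, hV, e⟩ := h
  obtain ⟨W, hW, e'⟩ := h'
  refine ⟨fun t => V t - W t, hV.sub hW, ?_⟩
  filter_upwards [e, e'] with t h1 h2
  rw [h1, h2]
  rfl

theorem MemCH.sub {v w : ℝ → L2 R} (h : MemCH R T n v) (h' : MemCH R T n w) :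
    MemCH R T n (fun t => v t - w t) := by
  obtain ⟨V, hV, e⟩ := h
  obtain ⟨W, hW, e'⟩ := h'
  refine ⟨fun t => V t - W t, hV.sub hW, fun t ht => ?_⟩
  simp only [e t ht, e' t ht]
  rfl

theorem MemCH.mono {v : ℝ → L2 R} (h : MemCH R T n v) {n' : ℕ} (hn : n' ≤ n) :
    MemCH R T n' v :=
  memCH_iff_smoothInto.2 ((memCH_iff_smoothInto.1 h).mono hn)

theorem MemL2H.mono {v : ℝ → L2 R} (h : MemL2H R T n v) {n' : ℕ} (hn : n' ≤ n) :
    MemL2H R T n' v := by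
  obtain ⟨V, hV, e⟩ := h
  exact ⟨fun t => incl hn (V t), (incl hn).comp_memLp' hV, e⟩

theorem MemCH.continuousOn {v : ℝ → L2 R} (h : MemCH R T n v) : ContinuousOn v (Icc 0 T) :=
  contDiffOn_zero.1 (memCH_iff_smoothInto.1 h).contDiffOn

theorem memCH_zero {v : ℝ → L2 R} (h : ContinuousOn v (Icc 0 T)) : MemCH R T 0 v :=
  memCH_iff_smoothInto.2 (smoothInto_zero_iff.2 (contDiffOn_zero.2 h))

variable [hR : Fact (0 < R)]

theorem MemCH.of_isWeakDeriv {m : ℕ} {v s : ℝ → L2 R} (hv : ContinuousOn v (Icc 0 T))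
    (hs : MemCH R T n s) (h : ∀ t ∈ Icc 0 T, IsWeakDeriv 0 R m (v t) (s t)) :
    MemCH R T (n + m) v := by
  obtain ⟨S, hS, e⟩ := hs
  obtain ⟨Λ, hΛ⟩ := exists_lift (R := R) m n (n + m) rfl
  exact ⟨fun t => Λ (v t, S t), Λ.continuous.comp_continuousOn (hv.prodMk hS), fun t ht =>
    (hΛ _ _ (by have := h t ht; rwa [e t ht] at this)).symm⟩

theorem MemL2H.of_isWeakDeriv {m : ℕ} {v s : ℝ → L2 R} (hv : ContinuousOn v (Icc 0 T))
    (hs : MemL2H R T n s) (h : ∀ t ∈ Icc 0 T, IsWeakDeriv 0 R m (v t) (s t)) :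
    MemL2H R T (n + m) v := by
  obtain ⟨S, hS, e⟩ := hs
  obtain ⟨Λ, hΛ⟩ := exists_lift (R := R) m n (n + m) rfl
  -- The operator is split into its two partial maps, so that square integrability in `t` is checked
  -- for each summand separately.
  have hΛ' : ∀ u S, Λ.comp (ContinuousLinearMap.inl ℝ _ _) u +
      Λ.comp (ContinuousLinearMap.inr ℝ _ _) S = Λ (u, S) := fun u S => by
    simp [← map_add]
  refine ⟨fun t => Λ.comp (ContinuousLinearMap.inl ℝ _ _) (v t) +
    Λ.comp (ContinuousLinearMap.inr ℝ _ _) (S t),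
    ((Λ.comp (ContinuousLinearMap.inl ℝ _ _)).comp_memLp' (memLp_Ioo_of_continuousOn hv)).add
      ((Λ.comp (ContinuousLinearMap.inr ℝ _ _)).comp_memLp' hS), ?_⟩
  filter_upwards [e, ae_restrict_mem measurableSet_Ioo] with t h2 ht
  have := h t (Ioo_subset_Icc_self ht)
  rw [h2] at this
  rw [hΛ']
  exact (hΛ _ _ this).symm

/-- `v, v' ∈ L₂(0, T; Hⁿ(I))` implies `v ∈ C([0, T]; Hⁿ(I))`. -/
theorem MemL2H.memCH (hT : 0 < T) {v v' : ℝ → L2 R}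
    (hd : ∀ t ∈ Icc 0 T, HasDerivWithinAt v (v' t) (Icc 0 T) t)
    (hc : ContinuousOn v' (Icc 0 T)) (hv : MemL2H R T n v) (hv' : MemL2H R T n v') :
    MemCH R T n v := by
  obtain ⟨U, -, e⟩ := hv
  obtain ⟨U', hU', e'⟩ := hv'
  have hne : NeZero (volume.restrict (Ioo 0 T)) := ⟨by
    rw [Ne, Measure.restrict_eq_zero, Real.volume_Ioo]
    simpa using hT⟩
  -- The primitive starts at an interior time where `v` is known to lie in `Hⁿ(I)`; nothing is known
  -- at `t = 0` itself.
  obtain ⟨t₀, h0, ht₀⟩ := (e.and (ae_restrict_mem measurableSet_Ioo)).exists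
  have hint : IntegrableOn U' (Icc 0 T) := by
    rw [IntegrableOn, ← restrict_Ioo_eq_restrict_Icc (a := (0 : ℝ)) (b := T)]
    exact hU'.integrable (by norm_num)
  have hii : ∀ t ∈ Icc 0 T, IntervalIntegrable U' volume t₀ t := fun t ht =>
    (hint.mono_set (uIcc_subset_Icc (Ioo_subset_Icc_self ht₀) ht)).intervalIntegrable
  have hvc : ContinuousOn v (Icc 0 T) := fun t ht => (hd t ht).continuousWithinAt
  refine ⟨fun t => U t₀ + ∫ s in t₀..t, U' s, continuousOn_const.add ?_, fun t ht => ?_⟩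
  · have h1 := intervalIntegral.continuousOn_primitive_interval' (f := U') (μ := volume) (a := t₀)
      (b₁ := 0) (b₂ := T) (by
        refine IntegrableOn.intervalIntegrable ?_
        rwa [uIcc_of_le hT.le]) (by rw [uIcc_of_le hT.le]; exact Ioo_subset_Icc_self ht₀)
    rwa [uIcc_of_le hT.le] at h1
  · change v t = iota n (U t₀ + ∫ s in t₀..t, U' s)
    have hsub : uIcc t₀ t ⊆ Icc 0 T := uIcc_subset_Icc (Ioo_subset_Icc_self ht₀) ht
    have hftc := intervalIntegral.integral_eq_sub_of_hasDeriv_right (f := v) (f' := v')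
      (a := t₀) (b := t) (hvc.mono hsub) (fun x hx => by
        have hx' : x ∈ Icc 0 T := hsub (Ioo_subset_Icc_self hx)
        have hx0 : x ∈ Ico 0 T := ⟨hx'.1, hx.2.trans_le (max_le ht₀.2.le ht.2)⟩
        exact ((hd x hx').mono_of_mem_nhdsWithin (Icc_mem_nhdsGE_of_mem hx0)).mono Ioi_subset_Ici_self)
      ((hc.mono hsub).intervalIntegrable)
    rw [map_add, ← ContinuousLinearMap.intervalIntegral_comp_comm (iota n) (hii t ht)]
    have h2 : ∫ s in t₀..t, iota n (U' s) = ∫ s in t₀..t, v' s := by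
      refine intervalIntegral.integral_congr_ae_restrict ?_
      have : ∀ᵐ s ∂(volume.restrict (Icc 0 T)), iota n (U' s) = v' s := by
        rw [← restrict_Ioo_eq_restrict_Icc]
        filter_upwards [e'] with s hs using hs.symm
      exact ae_restrict_of_ae_restrict_of_subset (uIoc_subset_uIcc.trans hsub) this
    rw [h2, hftc, iota_apply, ← h0]
    abel

/-- The derivatives in `t` are known only in `L₂(I)`. The `Hⁿ`-valued primitive of the lift of `v (m
+ 1)` has the same `L₂` derivative and initial value as `v m`, so by injectivity of `iota` it is the
lift of `v m`. -/
theorem smoothInto_of_tower (hT : 0 < T) {v : ℕ → ℝ → L2 R}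
    (hd : ∀ m < N, ∀ t ∈ Icc 0 T, HasDerivWithinAt (v m) (v (m + 1) t) (Icc 0 T) t)
    (hv : ∀ m ≤ N, MemCH R T n (v m)) : SmoothInto T N n (v 0) := by
  have h' : ∀ m, ∃ V : ℝ → H R n, m ≤ N → ContinuousOn V (Icc 0 T) ∧
      ∀ t ∈ Icc 0 T, v m t = iota n (V t) := by
    intro m
    by_cases hm : m ≤ N
    · obtain ⟨V, h⟩ := hv m hm
      exact ⟨V, fun _ => h⟩
    · exact ⟨0, fun h => absurd h hm⟩
  choose V hV using h'
  have hdV : ∀ m < N, ∀ t ∈ Icc 0 T, HasDerivWithinAt (V m) (V (m + 1) t) (Icc 0 T) t := by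
    intro m hm t ht
    have h0 : (0 : ℝ) ∈ Icc 0 T := left_mem_Icc.2 hT.le
    obtain ⟨W, hW0, hW⟩ := exists_hasDerivWithinAt hT (hV (m + 1) hm).1 (V m 0)
    have hE : EqOn (v m) (fun t => iota n (W t)) (Icc 0 T) :=
      eqOn_of_hasDerivWithinAt (hd m hm) (fun t ht => by
        rw [(hV (m + 1) hm).2 t ht]
        exact (iota n).hasFDerivAt.comp_hasDerivWithinAt t (hW t ht))
        (by rw [hW0, (hV m hm.le).2 0 h0])
    have hVW : EqOn (V m) W (Icc 0 T) := fun s hs => iota_injective n (by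
      rw [← (hV m hm.le).2 s hs, hE hs])
    exact (hW t ht).congr hVW (hVW ht)
  exact ⟨V 0, contDiffOn_of_tower hT hdV (hV N le_rfl).1, (hV 0 (Nat.zero_le _)).2⟩

omit hR in
theorem SmoothInto.memCH_iteratedDerivWithin (hT : 0 < T) {v : ℝ → L2 R}
    (h : SmoothInto T N n v) {m : ℕ} (hm : m ≤ N) :
    MemCH R T n (iteratedDerivWithin m v (Icc 0 T)) := by
  obtain ⟨V, hV, e⟩ := h
  have hd := hasDerivWithinAt_iteratedDerivWithin hT hV
  have h1 := iteratedDerivWithin_eq_of_tower hT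
    (V := fun m t => iota n (iteratedDerivWithin m V (Icc 0 T) t))
    (fun m hm t ht => (iota n).hasFDerivAt.comp_hasDerivWithinAt t (hd m hm t ht)) m hm
  refine ⟨iteratedDerivWithin m V (Icc 0 T),
    hV.continuousOn_iteratedDerivWithin (by exact_mod_cast hm) (uniqueDiffOn_Icc hT), fun t ht => ?_⟩
  have h2 : EqOn v (fun t => iota n (iteratedDerivWithin 0 V (Icc 0 T) t)) (Icc 0 T) :=
    fun t ht => by simpa using e t ht
  rw [iteratedDerivWithin_congr h2 ht, h1 ht]
  rfl

end Lift

/-! ### The space derivative as an operator -/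

section Dx

variable {R T : ℝ} {n M : ℕ}

open Classical in
/-- The weak derivative in `L₂(I)` (zero if there is none). -/
def dx (u : L2 R) : L2 R := if h : ∃ v, IsWeakDeriv 0 R 1 u (v : L2 R) then h.choose else 0

theorem dx_eq {u v : L2 R} (h : IsWeakDeriv 0 R 1 u v) : dx u = v := by
  have h' : ∃ v, IsWeakDeriv 0 R 1 u (v : L2 R) := ⟨v, h⟩
  rw [dx, dif_pos h']
  exact h'.choose_spec.unique_of_L2 h

theorem SmoothInto.isWeakDeriv_dx {v : ℝ → L2 R} (h : SmoothInto T M (n + 1) v) {t : ℝ}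
    (ht : t ∈ Icc 0 T) : IsWeakDeriv 0 R 1 (v t) (dx (v t)) := by
  obtain ⟨V, hV, e⟩ := h
  rw [e t ht, dx_eq (isWeakDeriv_der (V t))]
  exact isWeakDeriv_der (V t)

theorem SmoothInto.dx {v : ℝ → L2 R} (h : SmoothInto T M (n + 1) v) :
    SmoothInto T M n (fun t => dx (v t)) := by
  obtain ⟨V, hV, e⟩ := h
  exact ⟨fun t => der n (V t), (der n).contDiff.comp_contDiffOn hV, fun t ht => by
    simp only [e t ht, dx_eq (isWeakDeriv_der (V t))]⟩

end Dx

/-! ### The equation -/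

section Equation

variable {R T b : ℝ} [hR : Fact (0 < R)]

omit hR in
theorem isTestFunction_mul {η χ : ℝ → ℝ} (hη : IsTest 0 T η) (hχ : IsTest 0 R χ) :
    IsTestFunction R T (fun t x => η t * χ x) where
  smooth := (hη.smooth.comp contDiff_fst).mul (hχ.smooth.comp contDiff_snd)
  final x _ := by simp [hη.eq_zero (x := T) (by simp)]
  left t _ := by simp [hχ.eq_zero (x := 0) (by simp)]
  left_deriv t _ := by
    rw [deriv_const_mul_field, hχ.deriv.eq_zero (x := 0) (by simp), mul_zero]
  right t _ := by simp [hχ.eq_zero (x := R) (by simp)]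

/-- For almost every `t` the integral identity holds on the level of test functions of `x`. -/
theorem IsSolution.identity (hT : 0 < T) {g : C(ℝ, ℝ)} {u₀ μ₀ ν₀ ν₁ : ℝ → ℝ}
    {f u F v v' : ℝ → L2 R} {w : ℝ → CI R}
    (hsol : IsSolution R T b g u₀ μ₀ ν₀ ν₁ f u)
    (hu : ∀ᵐ t ∂(volume.restrict (Ioo 0 T)), u t = v t)
    (hf : ∀ᵐ t ∂(volume.restrict (Ioo 0 T)), f t = F t)
    (hv : IsWeakDeriv 0 T 1 v v') (hvc : ContinuousOn v (Icc 0 T)) (hv'c : ContinuousOn v' (Icc 0 T))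
    (hF : ContinuousOn F (Icc 0 T)) (hw : ContinuousOn w (Icc 0 T))
    (hvw : ∀ t ∈ Icc 0 T, v t = embL (w t)) {χ : ℝ → ℝ} (hχ : IsTest 0 R χ) {ℓ ℓ₁ ℓ₃ : L2 R →L[ℝ] ℝ}
    (hℓ : ∀ v, ℓ v = ∫ y in Ioo 0 R, χ y • v y)
    (hℓ₁ : ∀ v, ℓ₁ v = ∫ y in Ioo 0 R, deriv χ y • v y)
    (hℓ₃ : ∀ v, ℓ₃ v = ∫ y in Ioo 0 R, iteratedDeriv 3 χ y • v y) :
    ∀ t ∈ Icc 0 T, ℓ₃ (v t) + b * ℓ₁ (v t) + ℓ (F t) + ℓ₁ (embL (nemytskii g (w t))) - ℓ (v' t) = 0 := by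
  have hGc : ContinuousOn (fun t => embL (nemytskii g (w t))) (Icc 0 T) :=
    embL.continuous.comp_continuousOn ((ContinuousMap.continuous_postcomp g).comp_continuousOn hw)
  set q : ℝ → ℝ := fun t => ℓ₃ (v t) + b * ℓ₁ (v t) + ℓ (F t) + ℓ₁ (embL (nemytskii g (w t))) with hq
  have hqc : ContinuousOn q (Icc 0 T) := by
    have h1 := ℓ₃.continuous.comp_continuousOn hvc
    have h2 := ℓ₁.continuous.comp_continuousOn hvc
    have h3 := ℓ.continuous.comp_continuousOn hF
    have h4 := ℓ₁.continuous.comp_continuousOn hGc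
    exact ((h1.add (h2.const_mul b)).add h3).add h4
  have hac : ContinuousOn (fun t => ℓ (v t)) (Icc 0 T) := ℓ.continuous.comp_continuousOn hvc
  have ha'c : ContinuousOn (fun t => ℓ (v' t)) (Icc 0 T) := ℓ.continuous.comp_continuousOn hv'c
  have hloc : ∀ {p : ℝ → ℝ}, ContinuousOn p (Icc 0 T) → LocallyIntegrableOn p (Ioo 0 T) :=
    fun hp => (hp.mono Ioo_subset_Icc_self).locallyIntegrableOn measurableSet_Ioo
  -- Vanishing almost everywhere is encoded as a weak derivative of order zero. Continuity of both
  -- sides then yields the identity at every `t`.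
  have hweak : IsWeakDeriv 0 T 0 (fun t => q t - ℓ (v' t)) 0 := by
    refine ⟨hloc (hqc.sub ha'c), hloc continuousOn_const, fun η h1 h2 h3 => ?_⟩
    have hη : IsTest 0 T η := ⟨h1, h2, h3⟩
    -- With `η(t) χ(x)` compactly supported inside `Q_T`, the initial and boundary integrals vanish
    -- and only the equation remains.
    have hs := hsol _ (isTestFunction_mul hη hχ)
    have e2 : ∫ x in Ioo 0 R, u₀ x * (η 0 * χ x) = 0 := by
      simp [hη.eq_zero (x := 0) (by simp)]
    have e3 : ∫ t in Ioo 0 T, (μ₀ t * iteratedDeriv 2 (fun x => η t * χ x) 0 -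
        ν₀ t * iteratedDeriv 2 (fun x => η t * χ x) R + ν₁ t * deriv (fun x => η t * χ x) R) = 0 := by
      simp [iteratedDeriv_const_mul_field, deriv_const_mul_field, hχ.deriv.eq_zero (x := R) (by simp),
        (hχ.iteratedDeriv 2).eq_zero (x := R) (by simp),
        (hχ.iteratedDeriv 2).eq_zero (x := 0) (by simp)]
    rw [e2, e3, add_zero, add_zero] at hs
    have e1 : ∀ᵐ t ∂(volume.restrict (Ioo 0 T)), ∫ x in Ioo 0 R,
        (u t x * (deriv (fun s => η s * χ x) t + b * deriv (fun x => η t * χ x) x +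
          iteratedDeriv 3 (fun x => η t * χ x) x) + f t x * (η t * χ x) +
          g (u t x) * deriv (fun x => η t * χ x) x) = deriv η t • ℓ (v t) + η t • q t := by
      filter_upwards [hu, hf, ae_restrict_mem measurableSet_Ioo] with t hut hft ht
      have ht' := Ioo_subset_Icc_self ht
      rw [hut, hft]
      have i1 := integrable_test R (v t) _ hχ.smooth.continuous hχ.compact
      have i2 := integrable_test R (v t) _ hχ.deriv.smooth.continuous hχ.deriv.compact
      have i3 := integrable_test R (v t) _ (hχ.iteratedDeriv 3).smooth.continuous
        (hχ.iteratedDeriv 3).compact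
      have i4 := integrable_test R (F t) _ hχ.smooth.continuous hχ.compact
      have i5 := integrable_test R (embL (nemytskii g (w t))) _ hχ.deriv.smooth.continuous
        hχ.deriv.compact
      have i23 := i3.fun_add (i2.const_mul b)
      have i234 := i23.fun_add i4
      have i6 := i234.fun_add i5
      have e4 : q t = ∫ x in Ioo 0 R, (iteratedDeriv 3 χ x • v t x + b * (deriv χ x • v t x) +
          χ x • F t x + deriv χ x • (embL (nemytskii g (w t)) : L2 R) x) := by
        rw [hq]
        simp only [hℓ, hℓ₁, hℓ₃]
        rw [integral_add i234 i5, integral_add i23 i4, integral_add i3 (i2.const_mul b),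
          integral_const_mul]
      rw [e4, hℓ, ← integral_smul, ← integral_smul, ← integral_add (i1.fun_smul _) (i6.fun_smul _)]
      refine integral_congr_ae ?_
      filter_upwards [embL_ae (w t), embL_ae (nemytskii g (w t))] with x hx1 hx2
      rw [← hvw t ht'] at hx1
      have hx3 : (embL (nemytskii g (w t)) : L2 R) x = g (v t x) := by
        rw [hx2, hx1]; rfl
      rw [hx3, deriv_const_mul_field, deriv_mul_const_field, iteratedDeriv_const_mul_field]
      simp only [smul_eq_mul]
      ring
    rw [integral_congr_ae e1, integral_add (integrableOn_test_smul hη.deriv (hloc hac))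
      (integrableOn_test_smul hη (hloc hqc))] at hs
    -- The time derivative is moved from `η` to `v` by applying `ℓ` to the weak derivative identity
    -- in `L₂(I)`.
    have e5 : ∫ t in Ioo 0 T, deriv η t • ℓ (v t) = - ∫ t in Ioo 0 T, η t • ℓ (v' t) := by
      have e6 := congrArg ℓ (hv.2.2 η h1 h2 h3)
      rw [iteratedDeriv_one, pow_one, neg_one_smul, map_neg,
        ← ContinuousLinearMap.integral_comp_comm _ (integrableOn_test_smul hη.deriv hv.1),
        ← ContinuousLinearMap.integral_comp_comm _ (integrableOn_test_smul hη hv.2.1)] at e6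
      simpa only [map_smul] using e6
    simp only [iteratedDeriv_zero, smul_sub, Pi.zero_apply, smul_zero, integral_zero]
    rw [integral_sub (integrableOn_test_smul hη (hloc hqc)) (integrableOn_test_smul hη (hloc ha'c))]
    rw [e5] at hs
    linarith
  have h0 := hweak.ae_eq_of_zero
  rw [restrict_Ioo_eq_restrict_Icc (a := (0 : ℝ)) (b := T)] at h0
  exact Measure.eqOn_Icc_of_ae_eq volume hT.ne h0 (hqc.sub ha'c) continuousOn_const

/-- The lower order terms `b u_x + (g(u))_x` of the equation. -/
def lowerTerms (b : ℝ) (g : C(ℝ, ℝ)) (w : ℝ → CI R) (t : ℝ) : L2 R :=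
  b • dx (embL (w t)) + dx (embL (nemytskii g (w t)))

theorem SmoothC.lowerTerms {M n : ℕ} {w : ℝ → CI R} (hw : SmoothC T M n w) (b : ℝ) (g : C(ℝ, ℝ))
    (hg : ContDiff ℝ (M + n + 1 : ℕ) g) : SmoothInto T M n (lowerTerms b g w) :=
  (hw.smoothInto.dx.const_smul b).add (hw.nemytskii g hg).smoothInto.dx

/-- The equation, differentiated `m` times in `t`, on the level of `x`-derivatives. -/
theorem IsSolution.isWeakDeriv_three (hT : 0 < T) {N : ℕ} {g : C(ℝ, ℝ)} {u₀ μ₀ ν₀ ν₁ : ℝ → ℝ}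
    {f u : ℝ → L2 R} {F v : ℕ → ℝ → L2 R} {w : ℝ → CI R}
    (hsol : IsSolution R T b g u₀ μ₀ ν₀ ν₁ f u)
    (hu : ∀ᵐ t ∂(volume.restrict (Ioo 0 T)), u t = v 0 t)
    (hf : ∀ᵐ t ∂(volume.restrict (Ioo 0 T)), f t = F 0 t)
    (hv0 : IsWeakDeriv 0 T 1 (v 0) (v 1)) (hv1 : ContinuousOn (v 1) (Icc 0 T))
    (hv : ∀ m < N + 1, ∀ t ∈ Icc 0 T, HasDerivWithinAt (v m) (v (m + 1) t) (Icc 0 T) t)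
    (hF0 : ContinuousOn (F 0) (Icc 0 T))
    (hF : ∀ m < N, ∀ t ∈ Icc 0 T, HasDerivWithinAt (F m) (F (m + 1) t) (Icc 0 T) t)
    (hw : SmoothC T N 0 w) (hvw : ∀ t ∈ Icc 0 T, v 0 t = embL (w t))
    (hg : ContDiff ℝ (N + 1 : ℕ) g) :
    ∀ m ≤ N, ∀ t ∈ Icc 0 T, IsWeakDeriv 0 R 3 (v m t)
      (F m t - v (m + 1) t - iteratedDerivWithin m (lowerTerms b g w) (Icc 0 T) t : L2 R) := by
  intro m hm t ht
  rw [isWeakDeriv_L2_iff]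
  intro χ hχ
  obtain ⟨ℓ, hℓ⟩ := exists_pairing (R := R) _ hχ.smooth.continuous
  obtain ⟨ℓ₁, hℓ₁⟩ := exists_pairing (R := R) _ hχ.deriv.smooth.continuous
  obtain ⟨ℓ₃, hℓ₃⟩ := exists_pairing (R := R) _ (hχ.iteratedDeriv 3).smooth.continuous
  have hB := hasDerivWithinAt_iteratedDerivWithin hT (hw.lowerTerms b g hg).contDiffOn
  rw [← hℓ, ← hℓ₃]
  suffices h : ∀ m ≤ N, ∀ t ∈ Icc 0 T, ℓ₃ (v m t) =
      -ℓ (F m t - v (m + 1) t - iteratedDerivWithin m (lowerTerms b g w) (Icc 0 T) t) by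
    rw [h m hm t ht]
    simp only [smul_eq_mul]
    ring
  clear hm ht t m
  intro m
  induction m with
  | zero =>
    intro _ t ht
    have h := hsol.identity hT hu hf hv0 (fun t ht => (hv 0 N.succ_pos t ht).continuousWithinAt)
      hv1 hF0 hw.contDiffOn.continuousOn hvw hχ hℓ hℓ₁ hℓ₃ t ht
    have d1 := isWeakDeriv_L2_iff.1 (hw.smoothInto.isWeakDeriv_dx ht) χ hχ
    have d2 := isWeakDeriv_L2_iff.1 ((hw.nemytskii g hg).smoothInto.isWeakDeriv_dx ht) χ hχ
    rw [iteratedDeriv_one, ← hℓ, ← hℓ₁, pow_one, neg_one_smul] at d1 d2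
    rw [hvw t ht] at h ⊢
    rw [d1, d2] at h
    simp only [iteratedDerivWithin_zero, map_sub, lowerTerms, map_add, map_smul, smul_eq_mul, zero_add]
    linarith
  -- The scalar identity for `m` is differentiated in `t`. Since `χ` is fixed, no interchange of
  -- `∂ₜ` with `∂ₓ³` arises.
  | succ m ih =>
    intro hm t ht
    have h1 : HasDerivWithinAt (fun t => ℓ₃ (v m t)) (ℓ₃ (v (m + 1) t)) (Icc 0 T) t :=
      ℓ₃.hasFDerivAt.comp_hasDerivWithinAt t (hv m (by omega) t ht)
    have h2 := (ℓ.hasFDerivAt.comp_hasDerivWithinAt t (((hF m (by omega) t ht).sub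
      (hv (m + 1) (by omega) t ht)).sub (hB m (by omega) t ht))).neg
    exact (uniqueDiffOn_Icc hT t ht).eq_deriv _ h1 (h2.congr (fun s hs => ih (by omega) s hs)
      (ih (by omega) t ht))

end Equation

/-! ### The bootstrap: one derivative in `t` for three in `x`. -/

section Regularity

variable {R T b : ℝ} [hR : Fact (0 < R)]

/-- Interior regularity: if `∂ₜᵐ u` satisfies the differentiated equation, then each derivative in
time can be traded for three derivatives in space. -/
theorem regularity_induction (hT : 0 < T) {N : ℕ} {g : C(ℝ, ℝ)} {F v : ℕ → ℝ → L2 R}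
    {w : ℝ → CI R} (hg : ContDiff ℝ (3 * N + 2 : ℕ) g)
    (hv : ∀ m < N + 1, ∀ t ∈ Icc 0 T, HasDerivWithinAt (v m) (v (m + 1) t) (Icc 0 T) t)
    (hvc : ∀ m ≤ N + 1, ContinuousOn (v m) (Icc 0 T))
    (hv1 : ∀ m ≤ N + 1, MemL2H R T 1 (v m))
    (hF : ∀ m ≤ N, MemCH R T (3 * (N - m)) (F m) ∧ MemL2H R T (3 * (N - m) + 1) (F m))
    (hvw : ∀ t ∈ Icc 0 T, v 0 t = embL (w t))
    (heq : ∀ m ≤ N, ∀ t ∈ Icc 0 T, IsWeakDeriv 0 R 3 (v m t)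
      (F m t - v (m + 1) t - iteratedDerivWithin m (lowerTerms b g w) (Icc 0 T) t : L2 R))
    (j : ℕ) (hj : j ≤ N + 1) : ∀ m ≤ N + 1 - j,
      MemCH R T (3 * j) (v m) ∧ MemL2H R T (3 * j + 1) (v m) := by
  induction j with
  | zero => exact fun m hm => ⟨memCH_zero (hvc m hm), hv1 m hm⟩
  | succ j ih =>
    replace ih := ih (by omega)
    -- Used for `n = 3j` and then for `n = 3j + 1`. The nonlinearity needs `(N - j) + n + 1 ≤ N + 2j
    -- + 2` derivatives of `g`, at most `3N + 2` because `j ≤ N`.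
    have lower : ∀ n, 3 * j ≤ n → n ≤ 3 * j + 1 → (∀ m ≤ N - j, MemCH R T (n + 1) (v m)) →
        ∀ m ≤ N - j, MemCH R T n (iteratedDerivWithin m (lowerTerms b g w) (Icc 0 T)) := by
      intro n hn hn' h m hm
      obtain ⟨z, hz, e⟩ := (smoothInto_of_tower (N := N - j) hT
        (fun m hm => hv m (by omega)) h).exists_smoothC
      have hw : SmoothC T (N - j) n w := hz.congr fun t ht =>
        embL_injective ((hvw t ht).symm.trans (e t ht))
      exact (hw.lowerTerms b g (hg.of_le (by exact_mod_cast (by omega)))).memCH_iteratedDerivWithin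
        hT hm
    have c1 : ∀ m ≤ N - j, MemCH R T (3 * j + 1) (v m) := fun m hm =>
      (ih m (by omega)).2.memCH hT (hv m (by omega)) (hvc (m + 1) (by omega))
        (ih (m + 1) (by omega)).2
    have c3 : ∀ m ≤ N - j, MemCH R T (3 * j + 3) (v m) := fun m hm =>
      MemCH.of_isWeakDeriv (hvc m (by omega))
        ((((hF m (by omega)).1.mono (by omega)).sub (ih (m + 1) (by omega)).1).sub
          (lower (3 * j) le_rfl (by omega) c1 m hm)) (heq m (by omega))
    intro m hm
    refine ⟨c3 m (by omega), ?_⟩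
    -- Second pass: `c3` supplies the `C(H^{3j+2})` regularity that `c1` could not.
    have h2 := lower (3 * j + 1) (by omega) le_rfl
      (fun m hm => (c3 m hm).mono (by omega)) m (by omega)
    have h3 := MemL2H.of_isWeakDeriv (hvc m (by omega))
      ((((hF m (by omega)).2.mono (by omega)).sub (ih (m + 1) (by omega)).2).sub h2.memL2H)
      (heq m (by omega))
    exact h3.mono (by omega)

end Regularity

end GKdV

end

/-! ### The regularity theorem. -/

theorem corollary1p1 (k : ℕ) (hk : 1 ≤ k) (R T b : ℝ) (hR : 0 < R) (hT : 0 < T)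
    (g u₀ μ₀ ν₀ ν₁ : ℝ → ℝ) (f u : ℝ → GKdV.L2 R)
    (hg : ContDiff ℝ ((3 * k - 1 : ℕ) : WithTop ℕ∞) g) (hg0 : g 0 = 0) (hg1 : deriv g 0 = 0)
    (hu₀ : GKdV.MemH R (3 * k) u₀)
    (hμ₀ : GKdV.MemFracH T (k + 1 / 3) μ₀)
    (hν₀ : GKdV.MemFracH T (k + 1 / 3) ν₀)
    (hν₁ : GKdV.MemFracH T k ν₁)
    (hf : GKdV.MemM k R T f)
    (hcompat_μ₀ : ∀ m < k, GKdV.traceDeriv 0 T m μ₀ 0 =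
      GKdV.traceDeriv 0 R 0 (GKdV.Phi R T b g u₀ f m) 0)
    (hcompat_ν₀ : ∀ m < k, GKdV.traceDeriv 0 T m ν₀ 0 =
      GKdV.traceDeriv 0 R 0 (GKdV.Phi R T b g u₀ f m) R)
    (hcompat_ν₁ : ∀ m < k, GKdV.traceDeriv 0 T m ν₁ 0 =
      GKdV.traceDeriv 0 R 1 (GKdV.Phi R T b g u₀ f m) R)
    (hf' : ∀ m < k, ∃ v : ℝ → GKdV.L2 R, GKdV.IsWeakDeriv 0 T m f v ∧
      GKdV.MemCH R T (3 * (k - m - 1)) v ∧ GKdV.MemL2H R T (3 * (k - m) - 2) v)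
    (hu : GKdV.MemX k R T u)
    (hsol : GKdV.IsSolution R T b g u₀ μ₀ ν₀ ν₁ f u) :
    ∀ m < k, ∃ v : ℝ → GKdV.L2 R, GKdV.IsWeakDeriv 0 T m u v ∧
      GKdV.MemCH R T (3 * (k - m)) v ∧ GKdV.MemL2H R T (3 * (k - m) + 1) v := by

  -- With `k = N + 1` the truncated subtractions disappear: `3k - 1 = 3N + 2`, and `3(k - m) - 2 =
  -- 3(N - m) + 1` for `m ≤ N`.
  obtain ⟨N, rfl⟩ : ∃ N, k = N + 1 := ⟨k - 1, by omega⟩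
  have : Fact (0 < R) := ⟨hR⟩
  have hv' : ∀ m, ∃ v : ℝ → GKdV.L2 R, m ≤ N + 1 → GKdV.IsWeakDeriv 0 T m u v ∧
      ContinuousOn v (Icc 0 T) ∧ GKdV.MemL2H R T 1 v := by
    intro m
    by_cases hm : m ≤ N + 1
    · obtain ⟨v, h1, h2, h3, -⟩ := hu m hm
      exact ⟨v, fun _ => ⟨h1, h2, h3⟩⟩
    · exact ⟨0, fun h => absurd h hm⟩
  have hF' : ∀ m, ∃ v : ℝ → GKdV.L2 R, m ≤ N → GKdV.IsWeakDeriv 0 T m f v ∧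
      GKdV.MemCH R T (3 * (N - m)) v ∧ GKdV.MemL2H R T (3 * (N - m) + 1) v := by
    intro m
    by_cases hm : m ≤ N
    · obtain ⟨v, h1, h2, h3⟩ := hf' m (by omega)
      exact ⟨v, fun _ => ⟨h1, h2.mono (by omega), h3.mono (by omega)⟩⟩
    · exact ⟨0, fun h => absurd h hm⟩
  choose v hv using hv'
  choose F hF using hF'
  have hvd : ∀ m < N + 1, ∀ t ∈ Icc 0 T,
      HasDerivWithinAt (v m) (v (m + 1) t) (Icc 0 T) t := fun m hm =>
    ((hv m hm.le).1.tower (hv (m + 1) hm).1).hasDerivWithinAt hT (hv m hm.le).2.1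
      (hv (m + 1) hm).2.1
  have hFd : ∀ m < N, ∀ t ∈ Icc 0 T,
      HasDerivWithinAt (F m) (F (m + 1) t) (Icc 0 T) t := fun m hm =>
    ((hF m hm.le).1.tower (hF (m + 1) hm).1).hasDerivWithinAt hT (hF m hm.le).2.1.continuousOn
      (hF (m + 1) hm).2.1.continuousOn
  -- Already `u ∈ C^N([0,T]; H¹(I))`, so it has a representative `w` that is `C^N` with values in
  -- `C[0,R]`, on which `g` acts pointwise.
  obtain ⟨w, hw, hvw⟩ := (GKdV.smoothInto_of_tower (N := N) (n := 1) hT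
    (fun m hm => hvd m (by omega)) fun m hm => (hv m (by omega)).2.2.memCH hT (hvd m (by omega))
      (hv (m + 1) (by omega)).2.1 (hv (m + 1) (by omega)).2.2).exists_smoothC
  let G : C(ℝ, ℝ) := ⟨g, hg.continuous⟩
  have hG : ContDiff ℝ (3 * N + 2 : ℕ) G := hg.of_le (by exact_mod_cast (by omega))
  have heq := GKdV.IsSolution.isWeakDeriv_three (g := G) (F := F) (v := v) hT hsol
    (hv 0 (by omega)).1.ae_eq_of_zero (hF 0 (by omega)).1.ae_eq_of_zero
    ((hv 0 (by omega)).1.tower (hv 1 (by omega)).1) (hv 1 (by omega)).2.1 hvd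
    (hF 0 (by omega)).2.1.continuousOn hFd hw hvw (hG.of_le (by exact_mod_cast (by omega)))
  intro m hm
  -- For the `m`-th time derivative the induction is run to `j = N + 1 - m = k - m`, the last `j`
  -- that it allows for this `m`.
  have h := GKdV.regularity_induction hT hG hvd (fun m hm => (hv m hm).2.1)
    (fun m hm => (hv m hm).2.2) (fun m hm => (hF m hm).2) hvw heq (N + 1 - m) (by omega) m (by omega)
  exact ⟨v m, (hv m hm.le).1, h⟩
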